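/- Let $p>q\ge 0$ be integers, let $a_1,\dots,a_p,b_0,\dots,b_{p-1}\in\mathbb R$ with $b_q\neq 0$ and $b_j=0$ for $q<j<p$, and put $\mathbf b=(b_0,\dots,b_{p-1})^T$, $\mathbf e=(0,\dots,0,1)^T\in\mathbb R^p$. Let $\mathbf A\in\mathbb R^{p\times p}$ be the companion matrix with ones on the superdiagonal, last row $(-a_p,-a_{p-1},\dots,-a_1)$ and zeros elsewhere ($\mathbf A=(-a_1)$ if $p=1$). Assume that all eigenvalues of $\mathbf A$ have strictly negative real parts. On a probability space let $(L(t))_{t\ge 0}$ be a one-dimensional Lévy process (independent and stationary increments, $L(0)=0$ a.s., càdlàg paths) with $\mathbb E\,L(1)=0$ and $\mathbb E|L(1)|^2=\sigma^2<\infty$. Let $\widetilde L$ be an independent copy of $L$ and extend $L$ to $\mathbb R$ by $$L^*(t)=L(t)\mathbf 1_{[0,\infty)}(t)-\widetilde L(-t-)\mathbf 1_{(-\infty,0]}(t),$$ where $\widetilde L(0-):=\widetilde L(0)$. Let the $\mathbb R^p$-valued process $(\mathbf X(t))_{t\ge0}$ solve $d\mathbf X(t)=\mathbf A\mathbf X(t)\,dt+\mathbf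 e\,dL(t)$, where $\mathbf X(0)$ is independent of $(L(t))_{t\ge0}$ and $$\mathbf X(0)\stackrel{d}{=}\int_{-\infty}^0 e^{-\mathbf A u}\mathbf e\,dL^*(u)$$ (stochastic integrals of deterministic functions are $L^2$-limits of Riemann sums). Let $Y(t)=\mathbf b^T\mathbf X(t)$ be the corresponding CARMA process. For every $T>0$ let $N(T)\ge 2$ and let $0=x_0^{(T)}<x_1^{(T)}<\dots<x_{N(T)-1}^{(T)}=T$ be deterministic, not necessarily equidistant, observation points, and let $h_{\max}(T)=\max_{j=0,\dots,N(T)-2}\bigl(x_{j+1}^{(T)}-x_j^{(T)}\bigr)$. For $\omega\in\mathbb R$ put $F(t)=e^{-i\omega t}$ and $$\mathcal F_T(Y)(\omega)=\frac1{\sqrt T}\int_0^T Y(t)e^{-i\omega t}\,dt,\qquad \mathcal T_T(Y)(\omega)=\frac1{\sqrt T}\sum_{j=0}^{N(T)-1}\alpha_jY\bigl(x_j^{(T)}\bigr),$$ where $\alpha_0=\frac{x_1^{(T)}-x_0^{(T)}}2F(x_0^{(T)})$, $\alpha_{N(T)-1}=\frac{x_{N(T)-1}^{(T)}-x_{N(T)-2}^{(T)}}2F(x_{N(T)-1}^{(T)})$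 and $\alpha_j=\frac{x_{j+1}^{(T)}-x_{j-1}^{(T)}}2F(x_j^{(T)})$ for $1\le j\le N(T)-2$. If $\lim_{T\to\infty}N(T)h_{\max}(T)^3=0$, then for every $\omega\in\mathbb R$ the difference $\mathcal T_T(Y)(\omega)-\mathcal F_T(Y)(\omega)$ is square integrable for every $T>0$, and $$\lim_{T\to\infty}\bigl\|\mathcal T_T(Y)(\omega)-\mathcal F_T(Y)(\omega)\bigr\|_{L^2}=0,$$ and consequently $\mathcal T_T(Y)(\omega)-\mathcal F_T(Y)(\omega)\to0$ in probability as $T\to\infty$. -/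

import Mathlib

open MeasureTheory ProbabilityTheory Filter Topology
open scoped NNReal ENNReal Matrix

/-- The path `f : [0,∞) → ℝ` is right-continuous and has finite left limits. -/
def IsCadlagPath (f : ℝ≥0 → ℝ) : Prop :=
  ∀ t : ℝ≥0, ContinuousWithinAt f (Set.Ici t) t ∧ ∃ l : ℝ, Tendsto f (𝓝[<] t) (𝓝 l)

/-- A real-valued Lévy process `(L(t))_{t ≥ 0}`: it starts at `0`, has independent and stationary
increments, and its paths are almost surely càdlàg. -/
structure IsLevyProcess {Ω : Type*} [MeasurableSpace Ω] (P : Measure Ω) (L : ℝ≥0 → Ω → ℝ) :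
    Prop where
  measurable : ∀ t, Measurable (L t)
  zero : ∀ᵐ ω ∂P, L 0 ω = 0
  indepIncrements : HasIndepIncrements L P
  statIncrements : ∀ s h : ℝ≥0, IdentDistrib (fun ω => L (s + h) ω - L s ω) (L h) P P
  cadlag : ∀ᵐ ω ∂P, IsCadlagPath (fun t => L t ω)

/-- `L'` is an independent copy of the process `L`: the two have the same law as random elements
of the path space `[0,∞) → ℝ` (with the product σ-algebra), and they are independent. -/
def IsIndepCopy {Ω : Type*} [MeasurableSpace Ω] (P : Measure Ω) (L L' : ℝ≥0 → Ω → ℝ) : Prop :=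
  IdentDistrib (fun ω t => L t ω) (fun ω t => L' t ω) P P ∧
    IndepFun (fun ω t => L t ω) (fun ω t => L' t ω) P

/-- The two-sided extension `L*(t) = L(t) 1_{[0,∞)}(t) - L'((-t)-) 1_{(-∞,0]}(t)`. At `t = 0`
the left limit `L'(0-)` is read as `L'(0)`. -/
noncomputable def twoSided {Ω : Type*} (L L' : ℝ≥0 → Ω → ℝ) (t : ℝ) (ω : Ω) : ℝ :=
  (if 0 ≤ t then L t.toNNReal ω else 0) -
    (if t ≤ 0 then Function.leftLim (fun s : ℝ≥0 => L' s ω) (-t).toNNReal else 0)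

/-- `x 0, …, x (n-1)` are `n` points with `a = x 0 < x 1 < ⋯ < x (n-1) = b`. -/
def IsGrid (n : ℕ) (x : ℕ → ℝ) (a b : ℝ) : Prop :=
  0 < n ∧ x 0 = a ∧ x (n - 1) = b ∧ StrictMonoOn x (Set.Iio n)

/-- The maximal step `max_{j = 0, …, n-2} (x (j+1) - x j)`. -/
noncomputable def maxStep (n : ℕ) (x : ℕ → ℝ) : ℝ :=
  ⨆ j : Fin (n - 1), (x (j + 1) - x j)

/-- The Riemann sum `∑_{j=0}^{n-2} f(x_j) (Z(x_{j+1}) - Z(x_j))`. -/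
def riemannSum {Ω : Type*} (Z : ℝ → Ω → ℝ) (f : ℝ → ℝ) (n : ℕ) (x : ℕ → ℝ) (ω : Ω) : ℝ :=
  ∑ j ∈ Finset.range (n - 1), f (x j) * (Z (x (j + 1)) ω - Z (x j) ω)

/-- `I = ∫_a^b f(u) dZ(u)` for a deterministic `f`: `I` is the limit in `L²` of the Riemann sums
over grids of `[a,b]`, as the maximal step tends to zero. -/
def IsStochIntegral {Ω : Type*} [MeasurableSpace Ω] (P : Measure Ω) (Z : ℝ → Ω → ℝ) (f : ℝ → ℝ)
    (a b : ℝ) (I : Ω → ℝ) : Prop :=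
  MemLp I 2 P ∧ ∀ ε : ℝ, 0 < ε → ∃ δ : ℝ, 0 < δ ∧ ∀ (n : ℕ) (x : ℕ → ℝ), IsGrid n x a b →
    maxStep n x < δ → eLpNorm (fun ω => riemannSum Z f n x ω - I ω) 2 P < ENNReal.ofReal ε

/-- `I = ∫_{-∞}^b f(u) dZ(u)`: the limit in `L²` of `∫_a^b f(u) dZ(u)` as `a → -∞`. -/
def IsStochIntegralIic {Ω : Type*} [MeasurableSpace Ω] (P : Measure Ω) (Z : ℝ → Ω → ℝ)
    (f : ℝ → ℝ) (b : ℝ) (I : Ω → ℝ) : Prop :=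
  MemLp I 2 P ∧ ∃ J : ℝ → Ω → ℝ, (∀ a ≤ b, IsStochIntegral P Z f a b (J a)) ∧
    Tendsto (fun a => eLpNorm (fun ω => J a ω - I ω) 2 P) atBot (𝓝 0)

/-- The companion matrix of `a(z) = z^p + a_1 z^{p-1} + ⋯ + a_p`, with ones on the superdiagonal
and last row `(-a_p, …, -a_1)`. The coefficient `a_k` is stored as `a (k-1)`. -/
def carmaMatrix {p : ℕ} (a : Fin p → ℝ) : Matrix (Fin p) (Fin p) ℝ :=
  Matrix.of fun i j =>
    if (i : ℕ) + 1 = p then -a j.rev else if (j : ℕ) = (i : ℕ) + 1 then 1 else 0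

/-- The vector `e = (0, …, 0, 1)` of `ℝ^p`. -/
def carmaE (p : ℕ) : Fin p → ℝ := fun i => if (i : ℕ) + 1 = p then 1 else 0

/-- All complex eigenvalues of the real matrix `A` have strictly negative real parts. -/
def IsHurwitzMatrix {p : ℕ} (A : Matrix (Fin p) (Fin p) ℝ) : Prop :=
  ∀ z : ℂ, Module.End.HasEigenvalue (Matrix.toLin' (A.map (algebraMap ℝ ℂ))) z → z.re < 0

/-- `X` solves the state equation `dX(t) = A X(t) dt + e dL(t)`, `t ≥ 0`, that is, almost surely,
`X(t) = X(0) + ∫_0^t A X(s) ds + e L(t)` for all `t ≥ 0`, with locally integrable paths. -/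
def SolvesStateEquation {Ω : Type*} [MeasurableSpace Ω] (P : Measure Ω) {p : ℕ}
    (A : Matrix (Fin p) (Fin p) ℝ) (e : Fin p → ℝ) (L : ℝ≥0 → Ω → ℝ)
    (X : ℝ≥0 → Ω → Fin p → ℝ) : Prop :=
  (∀ t, Measurable (X t)) ∧
    ∀ᵐ ω ∂P, ∀ t : ℝ≥0,
      IntervalIntegrable (fun s : ℝ => X s.toNNReal ω) volume 0 t ∧
        X t ω = X 0 ω + (∫ s in (0 : ℝ)..t, A *ᵥ X s.toNNReal ω) + L t ω • e

/-- `X(0)` has the same law as `∫_{-∞}^0 e^{-Au} e dZ(u)`; the vector integral is taken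
coordinate by coordinate. -/
def HasStationaryStart {Ω : Type*} [MeasurableSpace Ω] (P : Measure Ω) {p : ℕ}
    (A : Matrix (Fin p) (Fin p) ℝ) (e : Fin p → ℝ) (Z : ℝ → Ω → ℝ) (X₀ : Ω → Fin p → ℝ) : Prop :=
  ∃ I : Ω → Fin p → ℝ,
    (∀ i, IsStochIntegralIic P Z (fun u => (NormedSpace.exp ((-u) • A) *ᵥ e) i) 0
      (fun ω => I ω i)) ∧ IdentDistrib X₀ I P P

/-- The truncated Fourier transform `T^{-1/2} ∫_0^T y(t) e^{-iωt} dt` of a path `y` at the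
frequency `w`. -/
noncomputable def truncatedFourier (y : ℝ≥0 → ℝ) (w T : ℝ) : ℂ :=
  (1 / (Real.sqrt T : ℂ)) *
    ∫ t in (0 : ℝ)..T, (y t.toNNReal : ℂ) * Complex.exp (-(Complex.I * w * t))

/-- The trapezoidal coefficients `α_0, …, α_{n-1}` of `F` for the grid `x 0, …, x (n-1)`. -/
noncomputable def trapCoeff (F : ℝ → ℂ) (n : ℕ) (x : ℕ → ℝ) (j : ℕ) : ℂ :=
  if j = 0 then ((x 1 - x 0) / 2 : ℝ) * F (x 0)
  else if j = n - 1 then ((x (n - 1) - x (n - 2)) / 2 : ℝ) * F (x (n - 1))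
  else ((x (j + 1) - x (j - 1)) / 2 : ℝ) * F (x j)

/-- The trapezoidal approximation `T^{-1/2} ∑_{j=0}^{n-1} α_j y(x_j)` of the truncated Fourier
transform, where the `α_j` are the trapezoidal coefficients of `F(t) = e^{-iωt}`. -/
noncomputable def trapezoidalFourier (y : ℝ≥0 → ℝ) (w T : ℝ) (n : ℕ) (x : ℕ → ℝ) : ℂ :=
  (1 / (Real.sqrt T : ℂ)) *
    ∑ j ∈ Finset.range n,
      trapCoeff (fun t => Complex.exp (-(Complex.I * w * t))) n x j * (y (x j).toNNReal : ℂ)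

/-!
The error of the trapezoidal rule is expanded on each grid interval `[s,t]`, of length `d`. Put
`ℓ(v) = b ⬝ᵥ v` and `F(u) = e^{-iwu}`. By the state equation, for `u ∈ [s,t]`,

  `F(u) ℓ(X(u)) = F(s) [ℓ(X(s)) + (u - s) (ℓ(A X(s)) - i w ℓ(X(s)))]`
  `                + F(s) ℓ(e) (L(u) - L(s)) + R(u)`,

where `R(u)` is of order `d^{3/2}` in mean square (`eLpNorm_affine_remainder_le`). The rule is exact
on the first, affine term.

The second term has an error of order `d^{3/2}` in mean square. Errors of this kind on different
intervals are orthogonal, because `L` has independent centred increments, so their squares add up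
to order `∑ d³ ≤ h² T` with `h` the maximal step. The remainder has an error of order `d^{5/2}`, and
the triangle inequality gives a total of order `h^{3/2} T`. After division by `√T` the mean-square
error is therefore of order `h + h^{3/2} √T` (`eLpNorm_sum_trapezoidError_le`). Since `T ≤ N h`,
the assumption `N h³ → 0` gives `T h² → 0`, hence `h → 0`, and the bound tends to zero.

The constants have to be uniform in time, which needs `sup_t E|X(t)|² < ∞`. The Hurwitz condition
provides a `τ` with `‖exp(τA)‖ ≤ 1/2`: the eigenvalues of `exp A` are exponentials of those of `A`,
and Gelfand's formula applies. By variation of constants the `L²` norm of `X(t + τ)` is then at most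
half that of `X(t)` plus a constant (`exists_forall_eLpNorm_le`). The recursion starts from
`X(0) ∈ L²`, which holds because `X(0)` is distributed as a limit in `L²`.

The moments of `L` come from independence and stationarity of the increments. The variance is
additive and monotone in time. The mean is additive, and it vanishes at irrational times because
the paths are right-continuous (`IsLevyProcess.integral_eq_zero`). Right-continuity also gives the
joint measurability behind the uses of Fubini's theorem.
-/

/-! ### Moments of a centred Lévy process -/

/-- If the sum of two independent random variables is square integrable, then so is each summand:
by Fubini, `x + y` is square integrable in `x` for almost every fixed value `y`. -/
lemma memLp_two_left_of_indepFun_add {Ω : Type*} [MeasurableSpace Ω] {P : Measure Ω}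
    [IsProbabilityMeasure P] {X Y : Ω → ℝ} (hX : Measurable X) (hY : Measurable Y)
    (hXY : IndepFun X Y P) (h : MemLp (fun ω => X ω + Y ω) 2 P) : MemLp X 2 P := by
  have := Measure.isProbabilityMeasure_map (μ := P) hX.aemeasurable
  have := Measure.isProbabilityMeasure_map (μ := P) hY.aemeasurable
  have hprod := (indepFun_iff_map_prod_eq_prod_map_map hX.aemeasurable hY.aemeasurable).1 hXY
  have hsum : MemLp (fun z : ℝ × ℝ => z.1 + z.2) 2 ((P.map X).prod (P.map Y)) := by
    rw [← hprod]
    exact (memLp_map_measure_iff (by fun_prop) (by fun_prop)).2 h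
  have hint := ((memLp_two_iff_integrable_sq (by fun_prop)).1 hsum).prod_left_ae
  obtain ⟨y, hy⟩ := hint.exists
  have hy' : MemLp (fun x : ℝ => x + y) 2 (P.map X) :=
    (memLp_two_iff_integrable_sq (by fun_prop)).2 hy
  have hid : MemLp (fun x : ℝ => x) 2 (P.map X) := by
    simpa [Pi.sub_def] using hy'.sub (memLp_const y)
  exact (memLp_map_measure_iff (by fun_prop) hX.aemeasurable).1 hid

/-- The smallest multiple of `1 / (n + 1)` that is strictly larger than `t`. -/
noncomputable def gridAbove (n : ℕ) (t : ℝ≥0) : ℝ≥0 :=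
  ((⌊((n : ℝ≥0) + 1) * t⌋₊ + 1 : ℕ) : ℝ≥0) / ((n : ℝ≥0) + 1)

lemma le_gridAbove (n : ℕ) (t : ℝ≥0) : t ≤ gridAbove n t := by
  rw [gridAbove, le_div_iff₀ (by positivity), mul_comm]
  exact_mod_cast (Nat.lt_floor_add_one _).le

lemma gridAbove_le (n : ℕ) (t : ℝ≥0) : gridAbove n t ≤ t + 1 / ((n : ℝ≥0) + 1) := by
  rw [gridAbove, div_le_iff₀ (by positivity), add_mul t, one_div,
    inv_mul_cancel₀ (by positivity), mul_comm t]
  push_cast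
  gcongr
  exact Nat.floor_le (by positivity)

lemma tendsto_gridAbove (t : ℝ≥0) :
    Tendsto (fun n => gridAbove n t) atTop (𝓝[≥] t) := by
  refine tendsto_nhdsWithin_iff.2 ⟨?_, Eventually.of_forall fun n => le_gridAbove n t⟩
  refine tendsto_of_tendsto_of_tendsto_of_le_of_le tendsto_const_nhds ?_
    (fun n => le_gridAbove n t) (fun n => gridAbove_le n t)
  have : Tendsto (fun n : ℕ => 1 / ((n : ℝ≥0) + 1)) atTop (𝓝 0) :=
    tendsto_one_div_add_atTop_nhds_zero_nat
  simpa using tendsto_const_nhds.add this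

/-- A process with almost surely right-continuous paths is jointly measurable up to a null set. -/
lemma aemeasurable_uncurry_of_rightContinuous {Ω E : Type*} [MeasurableSpace Ω] {P : Measure Ω}
    [SFinite P] [TopologicalSpace E] [TopologicalSpace.PseudoMetrizableSpace E]
    [MeasurableSpace E] [BorelSpace E]
    {Z : ℝ≥0 → Ω → E} (hZ : ∀ t, Measurable (Z t))
    (hc : ∀ᵐ ω ∂P, ∀ t, ContinuousWithinAt (fun s => Z s ω) (Set.Ici t) t)
    (μ : Measure ℝ) [SFinite μ] :
    AEMeasurable (fun z : ℝ × Ω => Z z.1.toNNReal z.2) (μ.prod P) := by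
  refine aemeasurable_of_tendsto_metrizable_ae (u := atTop)
    (f := fun n (z : ℝ × Ω) => Z (gridAbove n z.1.toNNReal) z.2) (fun n => ?_) ?_
  · refine Measurable.aemeasurable ?_
    have h1 : Measurable fun z : ℕ × Ω => Z ((z.1 + 1 : ℕ) / ((n : ℝ≥0) + 1)) z.2 :=
      measurable_from_prod_countable_right fun k => hZ ((k + 1 : ℕ) / ((n : ℝ≥0) + 1))
    have h2 : Measurable fun z : ℝ × Ω => (⌊((n : ℝ≥0) + 1) * z.1.toNNReal⌋₊, z.2) :=
      (Nat.measurable_floor.comp (by fun_prop)).prodMk measurable_snd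
    exact h1.comp h2
  · have h : ∀ᵐ z ∂μ.prod P, ∀ t, ContinuousWithinAt (fun s => Z s z.2) (Set.Ici t) t :=
      Measure.quasiMeasurePreserving_snd.ae hc
    filter_upwards [h] with z hz
    exact (hz _).tendsto.comp (tendsto_gridAbove _)

namespace IsLevyProcess

variable {Ω : Type*} [MeasurableSpace Ω] {P : Measure Ω} {L : ℝ≥0 → Ω → ℝ}

lemma identDistrib_sub (h : IsLevyProcess P L) {s t : ℝ≥0} (hst : s ≤ t) :
    IdentDistrib (fun ω => L t ω - L s ω) (L (t - s)) P P := by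
  simpa [add_tsub_cancel_of_le hst] using h.statIncrements s (t - s)

lemma indepFun_sub_sub (h : IsLevyProcess P L) {r s t u : ℝ≥0} (hrs : r ≤ s) (hst : s ≤ t)
    (htu : t ≤ u) :
    IndepFun (fun ω => L s ω - L r ω) (fun ω => L u ω - L t ω) P := by
  let τ : ℕ → ℝ≥0
    | 0 => r
    | 1 => s
    | 2 => t
    | _ => u
  have := (h.indepIncrements.nat (t := τ) (monotone_nat_of_le_succ fun n => by
    match n with
    | 0 => exact hrs
    | 1 => exact hst
    | 2 => exact htu
    | _ + 3 => exact le_rfl)).indepFun (show (0 : ℕ) ≠ 2 by norm_num)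
  exact this

lemma indepFun_sub (h : IsLevyProcess P L) {s t : ℝ≥0} (hst : s ≤ t) :
    IndepFun (L s) (fun ω => L t ω - L s ω) P :=
  h.indepIncrements.indepFun_eval_sub zero_le hst h.zero

variable [IsProbabilityMeasure P]

lemma memLp (h : IsLevyProcess P L) (hL2 : MemLp (L 1) 2 P) (t : ℝ≥0) : MemLp (L t) 2 P := by
  have hle : ∀ t ≤ (1 : ℝ≥0), MemLp (L t) 2 P := fun t ht =>
    memLp_two_left_of_indepFun_add (h.measurable t) ((h.measurable 1).sub (h.measurable t))
      (h.indepFun_sub ht) (by simpa using hL2)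
  have hn : ∀ n : ℕ, ∀ t ≤ (n : ℝ≥0) + 1, MemLp (L t) 2 P := by
    intro n
    induction n with
    | zero => simpa using hle
    | succ n ih =>
      intro t ht
      rcases le_total t 1 with h1 | h1
      · exact hle t h1
      · have h2 : MemLp (L (t - 1)) 2 P := ih _ (tsub_le_iff_right.2 (by simpa using ht))
        have h3 := ((h.identDistrib_sub h1).memLp_iff (p := 2)).2 h2
        have h4 := h3.add hL2
        simpa [Pi.add_def] using h4
  obtain ⟨n, hn'⟩ := exists_nat_ge t
  exact hn n t (hn'.trans (by simp))

lemma integral_add (h : IsLevyProcess P L) (hL2 : MemLp (L 1) 2 P) (s t : ℝ≥0) :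
    ∫ ω, L (s + t) ω ∂P = ∫ ω, L s ω ∂P + ∫ ω, L t ω ∂P := by
  have hi : ∀ t, Integrable (L t) P := fun t => (h.memLp hL2 t).integrable (by norm_num)
  rw [← (h.statIncrements s t).integral_eq, integral_sub (hi _) (hi _)]
  ring

lemma variance_add (h : IsLevyProcess P L) (hL2 : MemLp (L 1) 2 P) (s t : ℝ≥0) :
    Var[L (s + t); P] = Var[L s; P] + Var[L t; P] := by
  have h1 := (h.indepFun_sub (s := s) (t := s + t) le_self_add).variance_add (h.memLp hL2 s)
    ((h.memLp hL2 _).sub (h.memLp hL2 _))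
  rw [← (h.statIncrements s t).variance_eq]
  rw [Pi.sub_def] at h1
  rw [← h1]
  congr 1
  ext ω
  simp

/-- The variance grows at most linearly, being additive and monotone in time. -/
lemma variance_le (h : IsLevyProcess P L) (hL2 : MemLp (L 1) 2 P) (t : ℝ≥0) :
    Var[L t; P] ≤ t * Var[L 1; P] := by
  have hmul : ∀ (n : ℕ) (t : ℝ≥0), Var[L (n * t); P] = n * Var[L t; P] := by
    intro n t
    induction n with
    | zero =>
      have := h.variance_add hL2 0 0
      simp only [add_zero] at this
      simp only [Nat.cast_zero, zero_mul]
      linarith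
    | succ n ih =>
      rw [Nat.cast_succ, add_mul, one_mul, h.variance_add hL2, ih]
      push_cast
      ring
  have hmono : ∀ s t : ℝ≥0, s ≤ t → Var[L s; P] ≤ Var[L t; P] := by
    intro s t hst
    rw [← add_tsub_cancel_of_le hst, h.variance_add hL2]
    linarith [variance_nonneg (L (t - s)) P]
  have hv := variance_nonneg (L 1) P
  have hb : ∀ n : ℕ, Var[L t; P] ≤ (t + 1 / ((n : ℝ) + 1)) * Var[L 1; P] := by
    intro n
    have h1 : ((n + 1 : ℕ) : ℝ≥0) * t ≤ ((⌈((n + 1 : ℕ) : ℝ≥0) * t⌉₊ : ℕ) : ℝ≥0) * 1 := by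
      simpa using Nat.le_ceil _
    have h2 := hmono _ _ h1
    rw [hmul, hmul] at h2
    have h3 : ((⌈((n + 1 : ℕ) : ℝ≥0) * t⌉₊ : ℕ) : ℝ) ≤ ((n : ℝ) + 1) * t + 1 := by
      have := (Nat.ceil_lt_add_one (a := ((n + 1 : ℕ) : ℝ≥0) * t) (by positivity)).le
      have h4 : (((⌈((n + 1 : ℕ) : ℝ≥0) * t⌉₊ : ℕ) : ℝ≥0) : ℝ) ≤
        ((((n + 1 : ℕ) : ℝ≥0) * t + 1 : ℝ≥0) : ℝ) := NNReal.coe_le_coe.2 this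
      simpa using h4
    have h5 : ((n : ℝ) + 1) * Var[L t; P] ≤ (((n : ℝ) + 1) * t + 1) * Var[L 1; P] := by
      push_cast at h2
      push_cast at h3
      exact h2.trans (by gcongr)
    have hn : (0 : ℝ) < n + 1 := by positivity
    have : ((n : ℝ) + 1) * Var[L t; P] ≤
        ((n : ℝ) + 1) * ((t + 1 / ((n : ℝ) + 1)) * Var[L 1; P]) := by
      convert h5 using 1
      field_simp
    exact le_of_mul_le_mul_left this hn
  have hlim : Tendsto (fun n : ℕ => ((t : ℝ) + 1 / ((n : ℝ) + 1)) * Var[L 1; P]) atTop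
      (𝓝 (((t : ℝ) + 0) * Var[L 1; P])) :=
    (tendsto_const_nhds.add tendsto_one_div_add_atTop_nhds_zero_nat).mul tendsto_const_nhds
  rw [add_zero] at hlim
  exact ge_of_tendsto' hlim hb

/-- A Lévy process that is centred at time `1` is centred at all times. At rational times this is
additivity of the mean. In general take rational `qₙ ↓ t`: the variable `L(qₙ) - L(t) + E L(t)` is
centred with vanishing variance, and converges to the constant `E L(t)`. -/
lemma integral_eq_zero (h : IsLevyProcess P L) (hL2 : MemLp (L 1) 2 P)
    (hL0 : ∫ ω, L 1 ω ∂P = 0) (t : ℝ≥0) : ∫ ω, L t ω ∂P = 0 := by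
  have hi : ∀ t, Integrable (L t) P := fun t => (h.memLp hL2 t).integrable (by norm_num)
  have hmul : ∀ (n : ℕ) (t : ℝ≥0), ∫ ω, L (n * t) ω ∂P = n * ∫ ω, L t ω ∂P := by
    intro n t
    induction n with
    | zero =>
      have := h.integral_add hL2 0 0
      simp only [add_zero] at this
      simp only [Nat.cast_zero, zero_mul]
      linarith
    | succ n ih =>
      rw [Nat.cast_succ, add_mul, one_mul, h.integral_add hL2, ih]
      push_cast
      ring
  have hq : ∀ n : ℕ, ∫ ω, L (gridAbove n t) ω ∂P = 0 := by
    intro n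
    set k := ⌊((n : ℝ≥0) + 1) * t⌋₊ + 1 with hk
    have h1 : ((n + 1 : ℕ) : ℝ≥0) * gridAbove n t = (k : ℝ≥0) * 1 := by
      rw [gridAbove, ← hk]
      push_cast
      field_simp
    have h2 := hmul (n + 1) (gridAbove n t)
    rw [h1, hmul, hL0, mul_zero] at h2
    have hn : ((n + 1 : ℕ) : ℝ) ≠ 0 := by positivity
    exact (mul_eq_zero.1 h2.symm).resolve_left hn
  set m := ∫ ω, L t ω ∂P with hm
  let V : ℕ → Ω → ℝ := fun n ω => L (gridAbove n t) ω - L t ω + m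
  have hVm : ∀ n, Measurable (V n) := fun n =>
    ((h.measurable _).sub (h.measurable _)).add_const _
  have hVL : ∀ n, MemLp (V n) 2 P := fun n =>
    ((h.memLp hL2 _).sub (h.memLp hL2 _)).add (memLp_const m)
  have hV0 : ∀ n, ∫ ω, V n ω ∂P = 0 := by
    intro n
    simp only [V]
    have h1 : Integrable (fun ω => L (gridAbove n t) ω - L t ω) P := (hi _).sub (hi _)
    rw [MeasureTheory.integral_add h1 (integrable_const _),
      integral_sub (hi _) (hi _), hq]
    simp [hm]
  have hVsq : ∀ n, ∫ ω, V n ω ^ 2 ∂P ≤ 1 / ((n : ℝ) + 1) * Var[L 1; P] := by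
    intro n
    rw [← variance_of_integral_eq_zero (hVm n).aemeasurable (hV0 n)]
    have h1 : Var[V n; P] = Var[L (gridAbove n t - t); P] := by
      rw [← (h.identDistrib_sub (le_gridAbove n t)).variance_eq]
      exact variance_add_const ((h.measurable _).sub (h.measurable _)).aestronglyMeasurable m
    rw [h1]
    refine (h.variance_le hL2 _).trans ?_
    gcongr
    · exact variance_nonneg _ _
    · have : gridAbove n t - t ≤ 1 / ((n : ℝ≥0) + 1) :=
        tsub_le_iff_left.2 (gridAbove_le n t)
      exact_mod_cast this
  have hlim : ∀ᵐ ω ∂P, Tendsto (fun n => ENNReal.ofReal (V n ω ^ 2)) atTop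
      (𝓝 (ENNReal.ofReal (m ^ 2))) := by
    filter_upwards [h.cadlag] with ω hω
    have h1 : Tendsto (fun n => L (gridAbove n t) ω) atTop (𝓝 (L t ω)) :=
      (hω t).1.tendsto.comp (tendsto_gridAbove t)
    have h2 : Tendsto (fun n => V n ω) atTop (𝓝 (L t ω - L t ω + m)) :=
      (h1.sub_const _).add_const _
    rw [sub_self, zero_add] at h2
    exact (ENNReal.continuous_ofReal.tendsto _).comp (h2.pow 2)
  have hfatou : ENNReal.ofReal (m ^ 2) ≤
      liminf (fun n => ∫⁻ ω, ENNReal.ofReal (V n ω ^ 2) ∂P) atTop := by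
    calc ENNReal.ofReal (m ^ 2) = ∫⁻ ω, ENNReal.ofReal (m ^ 2) ∂P := by simp
      _ = ∫⁻ ω, liminf (fun n => ENNReal.ofReal (V n ω ^ 2)) atTop ∂P :=
          lintegral_congr_ae (hlim.mono fun ω hω => hω.liminf_eq.symm)
      _ ≤ _ := lintegral_liminf_le fun n => ((hVm n).pow_const 2).ennreal_ofReal
  have hz : Tendsto (fun n => ∫⁻ ω, ENNReal.ofReal (V n ω ^ 2) ∂P) atTop (𝓝 0) := by
    have h1 : Tendsto (fun n : ℕ => ENNReal.ofReal (1 / ((n : ℝ) + 1) * Var[L 1; P])) atTop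
        (𝓝 (ENNReal.ofReal (0 * Var[L 1; P]))) :=
      (ENNReal.continuous_ofReal.tendsto _).comp
        (tendsto_one_div_add_atTop_nhds_zero_nat.mul tendsto_const_nhds)
    rw [zero_mul, ENNReal.ofReal_zero] at h1
    refine tendsto_of_tendsto_of_tendsto_of_le_of_le tendsto_const_nhds h1
      (fun _ => zero_le) fun n => ?_
    rw [← ofReal_integral_eq_lintegral_ofReal (hVL n).integrable_sq
      (Eventually.of_forall fun _ => sq_nonneg _)]
    exact ENNReal.ofReal_le_ofReal (hVsq n)
  rw [hz.liminf_eq] at hfatou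
  have : m ^ 2 ≤ 0 := by simpa using hfatou
  exact pow_eq_zero_iff (two_ne_zero) |>.1 (le_antisymm this (sq_nonneg m))

/-- The increments have standard deviation at most `σ √(t - s)`. -/
lemma eLpNorm_sub_le (h : IsLevyProcess P L) (hL2 : MemLp (L 1) 2 P)
    (hL0 : ∫ ω, L 1 ω ∂P = 0) {s t : ℝ≥0} (hst : s ≤ t) :
    eLpNorm (fun ω => L t ω - L s ω) 2 P ≤
      ENNReal.ofReal (√(Var[L 1; P]) * √(t - s)) := by
  rw [(h.identDistrib_sub hst).eLpNorm_eq,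
    ← ENNReal.ofReal_toReal (h.memLp hL2 (t - s)).eLpNorm_ne_top]
  refine ENNReal.ofReal_le_ofReal ?_
  rw [← Real.sqrt_mul (variance_nonneg _ _)]
  refine Real.le_sqrt_of_sq_le ?_
  have h1 := h.variance_le hL2 (t - s)
  rw [variance_of_integral_eq_zero (h.measurable _).aemeasurable
    (h.integral_eq_zero hL2 hL0 _), NNReal.coe_sub hst, mul_comm] at h1
  refine le_trans (le_of_eq ?_) h1
  rw [(h.memLp hL2 (t - s)).eLpNorm_eq_integral_rpow_norm (by norm_num) (by norm_num),
    ENNReal.toReal_ofReal (by positivity), ← Real.rpow_natCast, ← Real.rpow_mul (by positivity)]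
  norm_num

lemma integral_sub_mul_sub_eq_zero (h : IsLevyProcess P L) (hL2 : MemLp (L 1) 2 P)
    (hL0 : ∫ ω, L 1 ω ∂P = 0) {r s t u : ℝ≥0} (hrs : r ≤ s) (hst : s ≤ t) (htu : t ≤ u) :
    ∫ ω, (L s ω - L r ω) * (L u ω - L t ω) ∂P = 0 := by
  have hi : ∀ t, Integrable (L t) P := fun t => (h.memLp hL2 t).integrable (by norm_num)
  have := (h.indepFun_sub_sub hrs hst htu).integral_mul_eq_mul_integral
    ((h.measurable _).sub (h.measurable _)).aestronglyMeasurable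
    ((h.measurable _).sub (h.measurable _)).aestronglyMeasurable
  rw [Pi.mul_def] at this
  rw [this, integral_sub (hi _) (hi _), h.integral_eq_zero hL2 hL0, h.integral_eq_zero hL2 hL0]
  simp

end IsLevyProcess

/-! ### Mean-square bounds for pathwise integrals -/

lemma eLpNorm_two_eq_lintegral {α G : Type*} [MeasurableSpace α] [NormedAddCommGroup G]
    (μ : Measure α) (g : α → G) :
    eLpNorm g 2 μ = (∫⁻ x, ‖g x‖ₑ ^ 2 ∂μ) ^ (1 / 2 : ℝ) := by
  rw [eLpNorm_eq_lintegral_rpow_enorm_toReal (by norm_num) (by norm_num)]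
  simp

/-- Minkowski's integral inequality for a family that is bounded in `L²`. No integrability of the
paths is needed: where a path is not integrable its integral is zero. -/
lemma eLpNorm_two_intervalIntegral_le {Ω E : Type*} [MeasurableSpace Ω] {P : Measure Ω} [SFinite P]
    [NormedAddCommGroup E] [NormedSpace ℝ E] {f : ℝ → Ω → E} {a b : ℝ} (hab : a ≤ b) {C : ℝ≥0∞}
    (hf : AEStronglyMeasurable (fun z : ℝ × Ω => f z.1 z.2) ((volume.restrict (Set.Ioc a b)).prod P))
    (hC : ∀ u ∈ Set.Ioc a b, eLpNorm (f u) 2 P ≤ C) :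
    eLpNorm (fun ω => ∫ u in a..b, f u ω) 2 P ≤ ENNReal.ofReal (b - a) * C := by
  have hsq : ∀ {y z : ℝ≥0∞}, y ^ (1 / 2 : ℝ) ≤ z ↔ y ≤ z ^ 2 := by
    intro y z
    rw [← ENNReal.rpow_natCast z 2, one_div]
    exact ENNReal.rpow_inv_le_iff (by norm_num)
  -- Cauchy-Schwarz for almost every path
  have hpath : ∀ᵐ ω ∂P, ‖∫ u in a..b, f u ω‖ₑ ^ 2 ≤
      ENNReal.ofReal (b - a) * ∫⁻ u in Set.Ioc a b, ‖f u ω‖ₑ ^ 2 := by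
    have hm : ∀ᵐ ω ∂P, AEStronglyMeasurable (fun u => f u ω) (volume.restrict (Set.Ioc a b)) :=
      hf.prod_swap.prodMk_left
    filter_upwards [hm] with ω hω
    have h1 := eLpNorm_le_eLpNorm_mul_rpow_measure_univ (p := 1) (q := 2) (by norm_num) hω
    rw [eLpNorm_one_eq_lintegral_enorm, eLpNorm_two_eq_lintegral] at h1
    have h3 : ‖∫ u in a..b, f u ω‖ₑ ≤ ∫⁻ u in Set.Ioc a b, ‖f u ω‖ₑ := by
      rw [intervalIntegral.integral_of_le hab]
      exact enorm_integral_le_lintegral_enorm _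
    calc _ ≤ ((∫⁻ u in Set.Ioc a b, ‖f u ω‖ₑ ^ 2) ^ (1 / 2 : ℝ) *
          (ENNReal.ofReal (b - a)) ^ (1 / 2 : ℝ)) ^ 2 := by
          gcongr
          refine (h3.trans h1).trans (le_of_eq ?_)
          simp
          norm_num
      _ = _ := by
          rw [mul_pow, ← ENNReal.rpow_natCast, ← ENNReal.rpow_natCast, ← ENNReal.rpow_mul,
            ← ENNReal.rpow_mul, mul_comm]
          norm_num
  rw [eLpNorm_two_eq_lintegral, hsq]
  calc _ ≤ ∫⁻ ω, (ENNReal.ofReal (b - a) * ∫⁻ u in Set.Ioc a b, ‖f u ω‖ₑ ^ 2) ∂P :=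
        lintegral_mono_ae hpath
    _ = ENNReal.ofReal (b - a) * ∫⁻ u in Set.Ioc a b, ∫⁻ ω, ‖f u ω‖ₑ ^ 2 ∂P := by
        rw [lintegral_const_mul' _ _ ENNReal.ofReal_ne_top, lintegral_lintegral_swap]
        exact (hf.enorm.pow_const 2).prod_swap
    _ ≤ ENNReal.ofReal (b - a) * ∫⁻ u in Set.Ioc a b, C ^ 2 := by
        refine mul_le_mul_right (setLIntegral_mono measurable_const fun u hu => ?_) _
        have := hC u hu
        rwa [eLpNorm_two_eq_lintegral, hsq] at this
    _ = _ := by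
        simp
        ring

/-- If `V` is orthogonal to each `f u`, `a < u ≤ b`, then it is orthogonal to the integral of
`f`. -/
lemma integral_mul_intervalIntegral_eq_zero {Ω : Type*} [MeasurableSpace Ω] {P : Measure Ω}
    [IsProbabilityMeasure P] {V : Ω → ℝ} {f : ℝ → Ω → ℝ} {a b : ℝ} (hab : a ≤ b) {C : ℝ≥0∞}
    (hCtop : C ≠ ⊤) (hV : MemLp V 2 P)
    (hf : AEStronglyMeasurable (fun z : ℝ × Ω => f z.1 z.2) ((volume.restrict (Set.Ioc a b)).prod P))
    (hfu : ∀ u, AEStronglyMeasurable (f u) P)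
    (hC : ∀ u ∈ Set.Ioc a b, eLpNorm (f u) 2 P ≤ C)
    (h0 : ∀ u ∈ Set.Ioc a b, ∫ ω, V ω * f u ω ∂P = 0) :
    ∫ ω, V ω * (∫ u in a..b, f u ω) ∂P = 0 := by
  have hm : AEStronglyMeasurable (fun z : ℝ × Ω => V z.2 * f z.1 z.2)
      ((volume.restrict (Set.Ioc a b)).prod P) :=
    (hV.aestronglyMeasurable.comp_snd).mul hf
  have hint : Integrable (fun z : ℝ × Ω => V z.2 * f z.1 z.2)
      ((volume.restrict (Set.Ioc a b)).prod P) := by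
    refine ⟨hm, ?_⟩
    rw [hasFiniteIntegral_iff_enorm, lintegral_prod _ hm.enorm]
    calc _ ≤ ∫⁻ u in Set.Ioc a b, eLpNorm V 2 P * C := by
          refine setLIntegral_mono measurable_const fun u hu => ?_
          have h1 := eLpNorm_smul_le_mul_eLpNorm (p := 2) (q := 2) (r := 1) (hfu u)
            hV.aestronglyMeasurable
          rw [eLpNorm_one_eq_lintegral_enorm] at h1
          refine h1.trans ?_
          gcongr
          exact hC u hu
      _ < ⊤ := by
          simp [ENNReal.mul_lt_top_iff, hV.eLpNorm_lt_top, hCtop.lt_top]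
  have h1 : ∀ ω, V ω * (∫ u in a..b, f u ω) = ∫ u in Set.Ioc a b, V ω * f u ω := by
    intro ω
    rw [intervalIntegral.integral_of_le hab, integral_const_mul]
  simp_rw [h1]
  rw [← integral_integral_swap (f := fun u ω => V ω * f u ω) hint]
  exact setIntegral_eq_zero_of_forall_eq_zero h0

/-! ### Exponential of a Hurwitz matrix -/

section HurwitzExponential

attribute [local instance] Matrix.linftyOpNormedRing Matrix.linftyOpNormedAlgebra

lemma Matrix.exp_mulVec_of_mulVec_eq_smul {p : ℕ} {B : Matrix (Fin p) (Fin p) ℂ} {z : ℂ}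
    {v : Fin p → ℂ} (h : B *ᵥ v = z • v) : NormedSpace.exp B *ᵥ v = Complex.exp z • v := by
  have hpow : ∀ n : ℕ, (B ^ n) *ᵥ v = z ^ n • v := by
    intro n
    induction n with
    | zero => simp
    | succ n ih => rw [pow_succ, ← Matrix.mulVec_mulVec, h, Matrix.mulVec_smul, ih, smul_smul,
        pow_succ, mul_comm]
  have h1 := NormedSpace.exp_series_hasSum_exp' (𝕂 := ℂ) B
  have hc : Continuous fun M : Matrix (Fin p) (Fin p) ℂ => M *ᵥ v :=
    continuous_id.matrix_mulVec continuous_const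
  have h2 := h1.map (AddMonoidHom.mk' (fun M : Matrix (Fin p) (Fin p) ℂ => M *ᵥ v)
    fun M N => Matrix.add_mulVec M N v) hc
  have h3 := (NormedSpace.exp_series_hasSum_exp' (𝕂 := ℂ) z).smul_const v
  rw [← Complex.exp_eq_exp_ℂ] at h3
  refine h2.unique (h3.congr_fun ?_ )
  intro n
  simp [Matrix.smul_mulVec, hpow, smul_smul]

/-- Spectral mapping: the eigenspaces of `exp B` are invariant under `B`, so each of them contains
an eigenvector of `B`. -/
lemma Matrix.exists_eigenvalue_of_mem_spectrum_exp {p : ℕ} {B : Matrix (Fin p) (Fin p) ℂ} {z : ℂ}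
    (hz : z ∈ spectrum ℂ (NormedSpace.exp B)) :
    ∃ l : ℂ, Module.End.HasEigenvalue (Matrix.toLin' B) l ∧ Complex.exp l = z := by
  have hz' : Module.End.HasEigenvalue (Matrix.toLin' (NormedSpace.exp B)) z := by
    rw [Module.End.hasEigenvalue_iff_mem_spectrum, Matrix.spectrum_toLin']
    exact hz
  set f := Matrix.toLin' (NormedSpace.exp B) with hf
  set g := Matrix.toLin' B with hg
  have hcomm : Commute f g := by
    have h1 : Commute (NormedSpace.exp B) B := (Commute.refl B).exp_left
    have := h1.map (Matrix.toLinAlgEquiv' (R := ℂ))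
    exact this
  have hmaps : Set.MapsTo g (Module.End.eigenspace f z) (Module.End.eigenspace f z) :=
    Module.End.mapsTo_genEigenspace_of_comm hcomm z 1
  have hnt : Nontrivial (Module.End.eigenspace f z) := (Submodule.nontrivial_iff_ne_bot).2 hz'
  obtain ⟨l, hl⟩ := Module.End.exists_eigenvalue (g.restrict hmaps)
  obtain ⟨v, hv⟩ := hl.exists_hasEigenvector
  have hv0 : (v : Fin p → ℂ) ≠ 0 := fun h => hv.2 (Subtype.ext h)
  have hgv : g v = l • (v : Fin p → ℂ) := by
    have := congrArg Subtype.val hv.apply_eq_smul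
    exact this
  refine ⟨l, Module.End.hasEigenvalue_of_hasEigenvector
    (Module.End.hasEigenvector_iff.2 ⟨Module.End.mem_eigenspace_iff.2 hgv, hv0⟩), ?_⟩
  have h1 : f v = Complex.exp l • (v : Fin p → ℂ) :=
    Matrix.exp_mulVec_of_mulVec_eq_smul (by simpa [hg] using hgv)
  have h2 : f v = z • (v : Fin p → ℂ) := Module.End.mem_eigenspace_iff.1 v.2
  exact smul_left_injective ℂ hv0 (h1.symm.trans h2)

/-- By Gelfand's formula the powers of `exp A` tend to zero, since the spectral radius of `exp A`
is less than one. -/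
lemma IsHurwitzMatrix.tendsto_exp_nsmul {p : ℕ} {A : Matrix (Fin p) (Fin p) ℝ}
    (hA : IsHurwitzMatrix A) :
    Tendsto (fun n : ℕ => NormedSpace.exp (n • A)) atTop (𝓝 0) := by
  rcases Nat.eq_zero_or_pos p with rfl | hp
  · refine tendsto_const_nhds.congr fun n => Subsingleton.elim _ _
  have : Nonempty (Fin p) := ⟨⟨0, hp⟩⟩
  set B : Matrix (Fin p) (Fin p) ℂ := A.map (algebraMap ℝ ℂ) with hB
  have hr : spectralRadius ℂ (NormedSpace.exp B) < 1 := by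
    refine spectrum.spectralRadius_lt_of_forall_lt (NormedSpace.exp B) (r := 1) fun z hz => ?_
    obtain ⟨l, hl, rfl⟩ := Matrix.exists_eigenvalue_of_mem_spectrum_exp hz
    have := hA l hl
    rw [← NNReal.coe_lt_coe]
    simpa [Complex.norm_exp] using this
  have hpow : Tendsto (fun n : ℕ => NormedSpace.exp B ^ n) atTop (𝓝 0) := by
    obtain ⟨r, hr1, hr2⟩ := ENNReal.lt_iff_exists_nnreal_btwn.1 hr
    have hr2' : r < 1 := by exact_mod_cast hr2
    have h1 := (spectrum.pow_nnnorm_pow_one_div_tendsto_nhds_spectralRadius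
      (NormedSpace.exp B)).eventually_lt_const hr1
    refine squeeze_zero_norm' (a := fun n => (r : ℝ) ^ n) ?_
      (tendsto_pow_atTop_nhds_zero_of_lt_one r.2 hr2')
    filter_upwards [h1, eventually_gt_atTop 0] with n hn hn0
    have h2 : (‖NormedSpace.exp B ^ n‖₊ : ℝ≥0∞) ≤ (r : ℝ≥0∞) ^ n := by
      rw [← ENNReal.rpow_natCast]
      rw [one_div] at hn
      exact (ENNReal.rpow_inv_le_iff (by exact_mod_cast hn0)).1 hn.le
    exact_mod_cast h2
  have hmap : ∀ n : ℕ, NormedSpace.exp B ^ n =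
      (NormedSpace.exp (n • A)).map (algebraMap ℝ ℂ) := by
    intro n
    have h1 := NormedSpace.map_exp (algebraMap ℝ ℂ).mapMatrix
      (Continuous.matrix_map continuous_id Complex.continuous_ofReal) (n • A)
    rw [map_nsmul] at h1
    exact ((NormedSpace.exp_nsmul n B).symm.trans h1.symm)
  have hre : Tendsto (fun n : ℕ => (NormedSpace.exp B ^ n).map Complex.re) atTop
      (𝓝 ((0 : Matrix (Fin p) (Fin p) ℂ).map Complex.re)) :=
    ((Continuous.matrix_map continuous_id Complex.continuous_re).tendsto _).comp hpow
  convert hre using 2 with n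
  · rw [hmap]
    ext i j
    simp
  · ext i j
    simp

/-- The continuous linear map `v ↦ A v`. -/
noncomputable def Matrix.mulVecCLM {p : ℕ} (A : Matrix (Fin p) (Fin p) ℝ) :
    (Fin p → ℝ) →L[ℝ] (Fin p → ℝ) :=
  LinearMap.toContinuousLinearMap (Matrix.toLin' A)

@[simp] lemma Matrix.mulVecCLM_apply {p : ℕ} (A : Matrix (Fin p) (Fin p) ℝ) (v : Fin p → ℝ) :
    A.mulVecCLM v = A *ᵥ v := by
  simp [Matrix.mulVecCLM]

lemma IsHurwitzMatrix.exists_norm_exp_le_half {p : ℕ} {A : Matrix (Fin p) (Fin p) ℝ}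
    (hA : IsHurwitzMatrix A) :
    ∃ τ : ℝ, 0 < τ ∧ ‖NormedSpace.exp (τ • A.mulVecCLM)‖ ≤ 1 / 2 := by
  let φ : Matrix (Fin p) (Fin p) ℝ →+* ((Fin p → ℝ) →L[ℝ] (Fin p → ℝ)) :=
    { toFun := Matrix.mulVecCLM
      map_one' := by ext; simp
      map_mul' := fun A B => by ext; simp
      map_zero' := by ext; simp
      map_add' := fun A B => by ext; simp [Matrix.add_mulVec] }
  have hφ : Continuous φ := by
    have h : Continuous ((LinearMap.toContinuousLinearMap
      (𝕜 := ℝ) (E := Fin p → ℝ) (F' := Fin p → ℝ)).toLinearMap ∘ₗ (Matrix.toLin' (R := ℝ)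
        (m := Fin p) (n := Fin p)).toLinearMap) := LinearMap.continuous_of_finiteDimensional _
    exact h
  have h1 : Tendsto (fun n : ℕ => NormedSpace.exp (n • A.mulVecCLM)) atTop (𝓝 0) := by
    have h2 := (hφ.tendsto 0).comp hA.tendsto_exp_nsmul
    rw [map_zero] at h2
    refine h2.congr fun n => ?_
    have h3 := NormedSpace.map_exp φ hφ (n • A)
    rw [map_nsmul] at h3
    exact h3
  have h3 := h1.norm
  rw [norm_zero] at h3
  obtain ⟨n, hn, hn0⟩ := ((h3.eventually_le_const (by norm_num : (0 : ℝ) < 1 / 2)).and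
    (eventually_gt_atTop 0)).exists
  exact ⟨n, by exact_mod_cast hn0, by rwa [Nat.cast_smul_eq_nsmul]⟩

end HurwitzExponential

/-! ### The state process -/

lemma exists_norm_exp_smul_le {E : Type*} [NormedAddCommGroup E] [NormedSpace ℝ E]
    [CompleteSpace E] (A : E →L[ℝ] E) (τ : ℝ) :
    ∃ M : ℝ, ∀ r ∈ Set.Icc 0 τ, ‖NormedSpace.exp (r • A)‖ ≤ M :=
  isCompact_Icc.exists_bound_of_continuousOn fun r _ =>
    (hasDerivAt_exp_smul_const (𝕂 := ℝ) A r).continuousAt.continuousWithinAt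

/-- Variation of constants for the integral equation `x(s) = x(0) + ∫₀ˢ A x + g(s)` with a
right-continuous forcing term `g`. It follows by integrating the right derivative of
`s ↦ exp((r - s)A) (x(s) - g(s))`. -/
lemma variation_of_constants {E : Type*} [NormedAddCommGroup E] [NormedSpace ℝ E]
    [CompleteSpace E] (A : E →L[ℝ] E) {x g : ℝ → E} {r : ℝ} (hr : 0 ≤ r)
    (hint : ∀ a b, IntervalIntegrable x volume a b)
    (hx : ∀ s, 0 ≤ s → x s = x 0 + (∫ v in (0 : ℝ)..s, A (x v)) + g s)
    (hg : ∀ s, 0 ≤ s → ContinuousWithinAt g (Set.Ici s) s) :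
    x r = NormedSpace.exp (r • A) (x 0) + g r +
      ∫ v in (0 : ℝ)..r, NormedSpace.exp ((r - v) • A) (A (g v)) := by
  have hAint : ∀ a b, IntervalIntegrable (fun v => A (x v)) volume a b := fun a b =>
    ⟨A.integrable_comp (hint a b).1, A.integrable_comp (hint a b).2⟩
  set H : ℝ → E := fun s => x 0 + ∫ v in (0 : ℝ)..s, A (x v) with hH
  have hHc : Continuous H := continuous_const.add (intervalIntegral.continuous_primitive hAint 0)
  have hxH : ∀ s, 0 ≤ s → x s = H s + g s := hx
  have hxc : ∀ s, 0 ≤ s → ContinuousWithinAt x (Set.Ici s) s := fun s hs =>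
    (hHc.continuousWithinAt.add (hg s hs)).congr (fun y hy => hxH y (hs.trans hy)) (hxH s hs)
  have hHd : ∀ s ∈ Set.Ioo 0 r, HasDerivWithinAt H (A (x s)) (Set.Ioi s) s := by
    intro s hs
    refine HasDerivWithinAt.const_add _ ?_
    have hm : StronglyMeasurableAtFilter (fun v => A (x v)) (𝓝[>] s) volume := by
      refine ⟨Set.Ioc s (s + 1), Ioc_mem_nhdsGT (by linarith), ?_⟩
      exact (hAint s (s + 1)).1.aestronglyMeasurable
    exact (intervalIntegral.integral_hasDerivWithinAt_right (s := Set.Ici s) (t := Set.Ioi s)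
      (hAint 0 s) hm ((A.continuous.continuousAt.comp_continuousWithinAt (hxc s hs.1.le)).mono
        Set.Ioi_subset_Ici_self)).mono Set.Ioi_subset_Ici_self
  let G : ℝ → E →L[ℝ] E := fun s => NormedSpace.exp ((r - s) • A)
  have hGd : ∀ s, HasDerivAt G (-(G s * A)) s := by
    intro s
    have h1 := hasDerivAt_exp_smul_const (𝕂 := ℝ) A (r - s)
    have h2 := HasDerivAt.scomp s h1 ((hasDerivAt_id s).const_sub r)
    rw [neg_one_smul] at h2
    exact h2
  have hGc : Continuous G := continuous_iff_continuousAt.2 fun s => (hGd s).continuousAt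
  have hVd : ∀ s ∈ Set.Ioo 0 r,
      HasDerivWithinAt (fun s => G s (H s)) (G s (A (g s))) (Set.Ioi s) s := by
    intro s hs
    have h1 := (hGd s).hasDerivWithinAt (s := Set.Ioi s) |>.clm_apply (hHd s hs)
    convert h1 using 1
    rw [hxH s hs.1.le]
    simp
  have hgint : IntervalIntegrable g volume 0 r := by
    have h1 : IntervalIntegrable (fun s => x s - H s) volume 0 r :=
      (hint 0 r).sub (hHc.intervalIntegrable 0 r)
    refine h1.congr fun s hs => ?_
    rw [Set.uIoc_of_le hr] at hs
    simp [hxH s hs.1.le]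
  have hVint : IntervalIntegrable (fun s => G s (A (g s))) volume 0 r := by
    have hAg : IntervalIntegrable (fun v => A (g v)) volume 0 r :=
      ⟨A.integrable_comp hgint.1, A.integrable_comp hgint.2⟩
    rw [intervalIntegrable_iff_integrableOn_Ioc_of_le hr] at hAg ⊢
    obtain ⟨C, hC⟩ := (isCompact_Icc (a := (0 : ℝ)) (b := r)).exists_bound_of_continuousOn
      hGc.continuousOn
    refine Integrable.mono' (hAg.norm.const_mul C) ?_ ?_
    · exact (ContinuousLinearMap.apply ℝ E).flip.aestronglyMeasurable_comp₂
        hGc.aestronglyMeasurable hAg.aestronglyMeasurable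
    · refine (ae_restrict_mem measurableSet_Ioc).mono fun s hs => ?_
      exact (G s).le_of_opNorm_le (hC s ⟨hs.1.le, hs.2⟩) _
  have hfin := intervalIntegral.integral_eq_sub_of_hasDeriv_right_of_le hr
    (hGc.clm_apply hHc).continuousOn hVd hVint
  have hH0 : H 0 = x 0 := by simp [hH]
  have hG0 : G 0 = NormedSpace.exp (r • A) := by simp [G]
  have hGr : G r (H r) = H r := by simp [G]
  rw [hH0, hG0, hGr] at hfin
  rw [hfin, hxH r hr]
  abel

namespace SolvesStateEquation

variable {Ω : Type*} [MeasurableSpace Ω] {P : Measure Ω} {p : ℕ}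
  {A : Matrix (Fin p) (Fin p) ℝ} {e : Fin p → ℝ} {L : ℝ≥0 → Ω → ℝ} {X : ℝ≥0 → Ω → Fin p → ℝ}

lemma ae_intervalIntegrable (hX : SolvesStateEquation P A e L X) :
    ∀ᵐ ω ∂P, ∀ a b : ℝ, IntervalIntegrable (fun s : ℝ => X s.toNNReal ω) volume a b := by
  filter_upwards [hX.2] with ω hω
  have h0 : ∀ t : ℝ, IntervalIntegrable (fun s : ℝ => X s.toNNReal ω) volume 0 t := by
    intro t
    rcases le_total 0 t with ht | ht
    · exact (hω ⟨t, ht⟩).1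
    · refine (intervalIntegrable_const (c := X 0 ω)).congr fun s hs => ?_
      rw [Set.uIoc_of_ge ht] at hs
      simp [Real.toNNReal_of_nonpos hs.2]
  exact fun a b => (h0 a).symm.trans (h0 b)

/-- The state equation restarted at time `s`. -/
lemma ae_eq_add (hX : SolvesStateEquation P A e L X) :
    ∀ᵐ ω ∂P, ∀ s u : ℝ, 0 ≤ s → s ≤ u → X u.toNNReal ω = X s.toNNReal ω +
      (∫ v in s..u, A.mulVecCLM (X v.toNNReal ω)) + (L u.toNNReal ω - L s.toNNReal ω) • e := by
  filter_upwards [hX.2, hX.ae_intervalIntegrable] with ω hω hint s u hs hsu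
  have hAint : ∀ a b, IntervalIntegrable (fun v : ℝ => A.mulVecCLM (X v.toNNReal ω)) volume a b :=
    fun a b => ⟨ContinuousLinearMap.integrable_comp _ (hint a b).1,
      ContinuousLinearMap.integrable_comp _ (hint a b).2⟩
  have h1 := (hω s.toNNReal).2
  have h2 := (hω u.toNNReal).2
  rw [Real.coe_toNNReal _ hs] at h1
  rw [Real.coe_toNNReal _ (hs.trans hsu)] at h2
  have h3 := intervalIntegral.integral_add_adjacent_intervals (hAint 0 s) (hAint s u)
  simp only [Matrix.mulVecCLM_apply] at h3 ⊢
  rw [h2, h1, ← h3, sub_smul]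
  abel

lemma ae_rightContinuous (hX : SolvesStateEquation P A e L X)
    (hL : ∀ᵐ ω ∂P, IsCadlagPath fun t => L t ω) :
    ∀ᵐ ω ∂P, ∀ t, ContinuousWithinAt (fun s => X s ω) (Set.Ici t) t := by
  filter_upwards [hX.2, hX.ae_intervalIntegrable, hL] with ω hω hint hc t
  have hAint : ∀ a b, IntervalIntegrable (fun v : ℝ => A.mulVecCLM (X v.toNNReal ω)) volume a b :=
    fun a b => ⟨ContinuousLinearMap.integrable_comp _ (hint a b).1,
      ContinuousLinearMap.integrable_comp _ (hint a b).2⟩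
  have h1 : Continuous fun t : ℝ≥0 => X 0 ω + ∫ v in (0 : ℝ)..t, A.mulVecCLM (X v.toNNReal ω) :=
    continuous_const.add ((intervalIntegral.continuous_primitive hAint 0).comp
      NNReal.continuous_coe)
  simp only [Matrix.mulVecCLM_apply] at h1
  refine (h1.continuousWithinAt.add (ContinuousWithinAt.smul (hc t).1
    (continuousWithinAt_const (b := e)))).congr (fun s _ => ?_) ?_
  · exact (hω s).2
  · exact (hω t).2

lemma aestronglyMeasurable_uncurry [SFinite P] (hX : SolvesStateEquation P A e L X)
    (hL : ∀ᵐ ω ∂P, IsCadlagPath fun t => L t ω) (μ : Measure ℝ) [SFinite μ] :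
    AEStronglyMeasurable (fun z : ℝ × Ω => X z.1.toNNReal z.2) (μ.prod P) :=
  (aemeasurable_uncurry_of_rightContinuous hX.1 (hX.ae_rightContinuous hL) μ).aestronglyMeasurable

/-- Variation of constants for the state process restarted at time `t`. -/
lemma ae_eq_exp (hX : SolvesStateEquation P A e L X)
    (hL : ∀ᵐ ω ∂P, IsCadlagPath fun t => L t ω) {t u : ℝ} (ht : 0 ≤ t) (htu : t ≤ u) :
    ∀ᵐ ω ∂P, X u.toNNReal ω = NormedSpace.exp ((u - t) • A.mulVecCLM) (X t.toNNReal ω) +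
      (L u.toNNReal ω - L t.toNNReal ω) • e +
      ∫ v in t..u, NormedSpace.exp ((u - v) • A.mulVecCLM)
        (A.mulVecCLM ((L v.toNNReal ω - L t.toNNReal ω) • e)) := by
  filter_upwards [hX.ae_eq_add, hX.ae_intervalIntegrable, hL] with ω hω hint hc
  have h := variation_of_constants A.mulVecCLM (x := fun s => X (t + s).toNNReal ω)
    (g := fun s => (L (t + s).toNNReal ω - L t.toNNReal ω) • e) (sub_nonneg.2 htu) ?_ ?_ ?_
  · have h2 := intervalIntegral.integral_comp_add_left (a := 0) (b := u - t)
      (fun v => NormedSpace.exp ((u - v) • A.mulVecCLM)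
        (A.mulVecCLM ((L v.toNNReal ω - L t.toNNReal ω) • e))) t
    simp only [add_zero, add_sub_cancel] at h h2
    rw [← h2, h]
    simp only [sub_sub]
  · intro a b
    have := (hint (t + a) (t + b)).comp_add_left t
    simpa using this
  · intro s hs
    have h1 := hω t (t + s) ht (by linarith)
    have h2 := intervalIntegral.integral_comp_add_left (a := 0) (b := s)
      (fun v => A.mulVecCLM (X v.toNNReal ω)) t
    rw [add_zero] at h2
    rw [h2, add_zero]
    exact h1
  · intro s hs
    have h1 : ContinuousWithinAt (fun s : ℝ => L (t + s).toNNReal ω) (Set.Ici s) s := by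
      refine (hc (t + s).toNNReal).1.comp (f := fun s : ℝ => (t + s).toNNReal)
        (by fun_prop) fun v hv => ?_
      exact Real.toNNReal_le_toNNReal (by simpa using hv)
    exact (h1.sub continuousWithinAt_const).smul (continuousWithinAt_const (b := e))

end SolvesStateEquation

lemma eLpNorm_clm_apply_le {Ω E F : Type*} [MeasurableSpace Ω] {P : Measure Ω}
    [NormedAddCommGroup E] [NormedSpace ℝ E] [NormedAddCommGroup F] [NormedSpace ℝ F]
    (T : E →L[ℝ] F) (f : Ω → E) {c : ℝ} (hc : ‖T‖ ≤ c) :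
    eLpNorm (fun ω => T (f ω)) 2 P ≤ ENNReal.ofReal c * eLpNorm f 2 P :=
  eLpNorm_le_mul_eLpNorm_of_ae_le_mul
    (Eventually.of_forall fun ω => T.le_of_opNorm_le hc (f ω)) 2

lemma eLpNorm_smul_const_le {Ω E : Type*} [MeasurableSpace Ω] {P : Measure Ω}
    [NormedAddCommGroup E] [NormedSpace ℝ E] (f : Ω → ℝ) (e : E) :
    eLpNorm (fun ω => f ω • e) 2 P ≤ ENNReal.ofReal ‖e‖ * eLpNorm f 2 P :=
  eLpNorm_le_mul_eLpNorm_of_ae_le_mul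
    (Eventually.of_forall fun ω => by rw [norm_smul, mul_comm]) 2

namespace SolvesStateEquation

variable {Ω : Type*} [MeasurableSpace Ω] {P : Measure Ω} [SFinite P] {p : ℕ}
  {A : Matrix (Fin p) (Fin p) ℝ} {e : Fin p → ℝ} {L : ℝ≥0 → Ω → ℝ} {X : ℝ≥0 → Ω → Fin p → ℝ}
  {σ : ℝ}

/-- Variation of constants in mean square over times at most `τ`. The noise contributes a constant
that does not depend on the starting time. -/
lemma exists_eLpNorm_le_exp (hX : SolvesStateEquation P A e L X) (hLm : ∀ t, Measurable (L t))
    (hL : ∀ᵐ ω ∂P, IsCadlagPath fun t => L t ω) (hσ : 0 ≤ σ)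
    (hLσ : ∀ s u : ℝ, 0 ≤ s → s ≤ u →
      eLpNorm (fun ω => L u.toNNReal ω - L s.toNNReal ω) 2 P ≤ ENNReal.ofReal (σ * √(u - s)))
    (τ : ℝ) :
    ∃ C : ℝ≥0, ∀ t u : ℝ, 0 ≤ t → t ≤ u → u ≤ t + τ → eLpNorm (X u.toNNReal) 2 P ≤
      ENNReal.ofReal ‖NormedSpace.exp ((u - t) • A.mulVecCLM)‖ * eLpNorm (X t.toNNReal) 2 P +
        C := by
  obtain ⟨M, hM⟩ := exists_norm_exp_smul_le A.mulVecCLM τ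
  set D : ℝ≥0∞ := ENNReal.ofReal ‖e‖ * ENNReal.ofReal (σ * √τ) with hD
  set D' : ℝ≥0∞ := ENNReal.ofReal M * (ENNReal.ofReal ‖A.mulVecCLM‖ * D) with hD'
  have hfin : D + ENNReal.ofReal τ * D' ≠ ⊤ := by
    simp only [hD, hD']
    finiteness
  refine ⟨(D + ENNReal.ofReal τ * D').toNNReal, fun t u ht htu hut => ?_⟩
  rw [ENNReal.coe_toNNReal hfin, ← add_assoc]
  have hDv : ∀ v, t ≤ v → v ≤ u →
      eLpNorm (fun ω => (L v.toNNReal ω - L t.toNNReal ω) • e) 2 P ≤ D := by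
    intro v htv hvu
    refine (eLpNorm_smul_const_le _ e).trans ?_
    rw [hD]
    gcongr
    refine (hLσ t v ht htv).trans (ENNReal.ofReal_le_ofReal ?_)
    gcongr
    linarith
  have hLj : AEStronglyMeasurable (fun z : ℝ × Ω => L z.1.toNNReal z.2)
      ((volume.restrict (Set.Ioc t u)).prod P) :=
    (aemeasurable_uncurry_of_rightContinuous hLm
      (hL.mono fun ω h s => (h s).1) _).aestronglyMeasurable
  have hexp : Continuous fun v : ℝ => NormedSpace.exp ((u - v) • A.mulVecCLM) := by
    refine Continuous.comp (g := fun r : ℝ => NormedSpace.exp (r • A.mulVecCLM)) ?_ (by fun_prop)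
    exact continuous_iff_continuousAt.2 fun r =>
      (hasDerivAt_exp_smul_const (𝕂 := ℝ) A.mulVecCLM r).continuousAt
  have hjoint : AEStronglyMeasurable (fun z : ℝ × Ω =>
      NormedSpace.exp ((u - z.1) • A.mulVecCLM)
        (A.mulVecCLM ((L z.1.toNNReal z.2 - L t.toNNReal z.2) • e)))
      ((volume.restrict (Set.Ioc t u)).prod P) := by
    have h1 : AEStronglyMeasurable (fun z : ℝ × Ω => L z.1.toNNReal z.2 - L t.toNNReal z.2)
        ((volume.restrict (Set.Ioc t u)).prod P) :=
      hLj.sub ((hLm _).comp measurable_snd).aestronglyMeasurable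
    have h2 := A.mulVecCLM.continuous.comp_aestronglyMeasurable (h1.smul_const e)
    have h3 : AEStronglyMeasurable (fun z : ℝ × Ω => NormedSpace.exp ((u - z.1) • A.mulVecCLM))
        ((volume.restrict (Set.Ioc t u)).prod P) :=
      (hexp.measurable.comp measurable_fst).aestronglyMeasurable
    exact (ContinuousLinearMap.apply ℝ (Fin p → ℝ)).flip.aestronglyMeasurable_comp₂ h3 h2
  have hI := eLpNorm_two_intervalIntegral_le (P := P) (f := fun v ω =>
      NormedSpace.exp ((u - v) • A.mulVecCLM)
        (A.mulVecCLM ((L v.toNNReal ω - L t.toNNReal ω) • e))) htu hjoint (C := D') fun v hv => by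
    refine (eLpNorm_clm_apply_le _ _ (hM (u - v) ⟨by linarith [hv.2], by linarith [hv.1]⟩)).trans ?_
    rw [hD']
    gcongr
    refine (eLpNorm_clm_apply_le _ _ le_rfl).trans ?_
    gcongr
    exact hDv v hv.1.le hv.2
  have hXm : ∀ t, AEStronglyMeasurable (X t) P := fun t => (hX.1 t).aestronglyMeasurable
  have hm1 : AEStronglyMeasurable
      (fun ω => NormedSpace.exp ((u - t) • A.mulVecCLM) (X t.toNNReal ω)) P :=
    (ContinuousLinearMap.continuous _).comp_aestronglyMeasurable (hXm _)
  have hm2 : AEStronglyMeasurable (fun ω => (L u.toNNReal ω - L t.toNNReal ω) • e) P :=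
    (((hLm _).sub (hLm _)).aestronglyMeasurable).smul_const e
  have hm3 : AEStronglyMeasurable (fun ω => ∫ v in t..u,
      NormedSpace.exp ((u - v) • A.mulVecCLM)
        (A.mulVecCLM ((L v.toNNReal ω - L t.toNNReal ω) • e))) P := by
    simp_rw [intervalIntegral.integral_of_le htu]
    exact hjoint.prod_swap.integral_prod_right'
  rw [eLpNorm_congr_ae (hX.ae_eq_exp hL ht htu)]
  refine (eLpNorm_add_le (hm1.add hm2) hm3 (by norm_num)).trans ?_
  refine add_le_add ((eLpNorm_add_le hm1 hm2 (by norm_num)).trans ?_) (hI.trans ?_)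
  · exact add_le_add (eLpNorm_clm_apply_le _ _ le_rfl) (hDv u htu le_rfl)
  · gcongr
    linarith

/-- Second moments stay bounded: over a time `τ` with `‖exp(τA)‖ ≤ 1/2` the `L²` norm is at most
halved, up to an additive constant. -/
lemma exists_forall_eLpNorm_le (hX : SolvesStateEquation P A e L X) (hLm : ∀ t, Measurable (L t))
    (hL : ∀ᵐ ω ∂P, IsCadlagPath fun t => L t ω) (hσ : 0 ≤ σ)
    (hLσ : ∀ s u : ℝ, 0 ≤ s → s ≤ u →
      eLpNorm (fun ω => L u.toNNReal ω - L s.toNNReal ω) 2 P ≤ ENNReal.ofReal (σ * √(u - s)))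
    (hA : IsHurwitzMatrix A) (hX0 : MemLp (X 0) 2 P) :
    ∃ K : ℝ, 0 ≤ K ∧ ∀ t : ℝ≥0, eLpNorm (X t) 2 P ≤ ENNReal.ofReal K := by
  obtain ⟨τ, hτ, hhalf⟩ := hA.exists_norm_exp_le_half
  obtain ⟨M, hM⟩ := exists_norm_exp_smul_le A.mulVecCLM τ
  obtain ⟨C, hC⟩ := hX.exists_eLpNorm_le_exp hLm hL hσ hLσ τ
  set B : ℝ≥0∞ := eLpNorm (X 0) 2 P + 2 * C with hB
  have hBtop : B ≠ ⊤ := by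
    have := hX0.eLpNorm_ne_top
    finiteness
  have hn : ∀ n : ℕ, eLpNorm (X (n * τ : ℝ).toNNReal) 2 P ≤ B := by
    intro n
    induction n with
    | zero => simp [hB]
    | succ n ih =>
      have h1 := hC (n * τ) ((n + 1 : ℕ) * τ) (by positivity)
        (by push_cast; nlinarith) (by push_cast; linarith)
      have h2 : ((n + 1 : ℕ) : ℝ) * τ - n * τ = τ := by push_cast; ring
      rw [h2] at h1
      have h3 : ENNReal.ofReal ‖NormedSpace.exp (τ • A.mulVecCLM)‖ ≤ 2⁻¹ := by
        refine (ENNReal.ofReal_le_ofReal hhalf).trans (le_of_eq ?_)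
        rw [one_div, ENNReal.ofReal_inv_of_pos (by norm_num)]
        simp
      calc _ ≤ _ := h1
        _ ≤ 2⁻¹ * B + C := by gcongr
        _ = 2⁻¹ * eLpNorm (X 0) 2 P + (C + C) := by
            rw [hB, mul_add, ← mul_assoc, ENNReal.inv_mul_cancel (by norm_num) (by norm_num),
              one_mul, add_assoc]
        _ ≤ 1 * eLpNorm (X 0) 2 P + (C + C) := by
            gcongr
            exact ENNReal.inv_le_one.2 (by norm_num)
        _ = B := by rw [one_mul, hB, two_mul]
  have hKtop : ENNReal.ofReal M * B + C ≠ ⊤ := by finiteness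
  refine ⟨(ENNReal.ofReal M * B + C).toReal, by positivity, fun t => ?_⟩
  rw [ENNReal.ofReal_toReal hKtop]
  set n := ⌊(t : ℝ) / τ⌋₊ with hndef
  have h1 : (n : ℝ) * τ ≤ t := by
    rw [← le_div_iff₀ hτ]
    exact Nat.floor_le (by positivity)
  have h2 : (t : ℝ) ≤ n * τ + τ := by
    have := (Nat.lt_floor_add_one ((t : ℝ) / τ)).le
    rw [div_le_iff₀ hτ] at this
    linarith
  have h3 := hC (n * τ) t (by positivity) h1 h2
  rw [Real.toNNReal_coe] at h3
  refine h3.trans ?_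
  gcongr
  · exact hM _ ⟨by linarith, by linarith⟩
  · exact hn n

/-- The state process is `1/2`-Hölder in mean square at short range. -/
lemma exists_eLpNorm_sub_le (hX : SolvesStateEquation P A e L X) (hLm : ∀ t, Measurable (L t))
    (hL : ∀ᵐ ω ∂P, IsCadlagPath fun t => L t ω) (hσ : 0 ≤ σ)
    (hLσ : ∀ s u : ℝ, 0 ≤ s → s ≤ u →
      eLpNorm (fun ω => L u.toNNReal ω - L s.toNNReal ω) 2 P ≤ ENNReal.ofReal (σ * √(u - s)))
    {K : ℝ} (hK : 0 ≤ K) (hXK : ∀ t : ℝ≥0, eLpNorm (X t) 2 P ≤ ENNReal.ofReal K) :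
    ∃ K' : ℝ, 0 ≤ K' ∧ ∀ s u : ℝ, 0 ≤ s → s ≤ u → u ≤ s + 1 →
      eLpNorm (fun ω => X u.toNNReal ω - X s.toNNReal ω) 2 P ≤
        ENNReal.ofReal (K' * √(u - s)) := by
  refine ⟨‖A.mulVecCLM‖ * K + ‖e‖ * σ, by positivity, fun s u hs hsu hus => ?_⟩
  have hjoint : AEStronglyMeasurable (fun z : ℝ × Ω => A.mulVecCLM (X z.1.toNNReal z.2))
      ((volume.restrict (Set.Ioc s u)).prod P) :=
    A.mulVecCLM.continuous.comp_aestronglyMeasurable (hX.aestronglyMeasurable_uncurry hL _)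
  have hI := eLpNorm_two_intervalIntegral_le (P := P)
    (f := fun v ω => A.mulVecCLM (X v.toNNReal ω)) hsu hjoint
    (C := ENNReal.ofReal (‖A.mulVecCLM‖ * K)) fun v _ => by
      refine (eLpNorm_clm_apply_le _ _ le_rfl).trans ?_
      rw [ENNReal.ofReal_mul (norm_nonneg _)]
      gcongr
      exact hXK _
  have heq : (fun ω => X u.toNNReal ω - X s.toNNReal ω) =ᵐ[P] fun ω =>
      (∫ v in s..u, A.mulVecCLM (X v.toNNReal ω)) + (L u.toNNReal ω - L s.toNNReal ω) • e := by
    filter_upwards [hX.ae_eq_add] with ω hω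
    rw [hω s u hs hsu]
    abel
  have hm2 : AEStronglyMeasurable (fun ω => (L u.toNNReal ω - L s.toNNReal ω) • e) P :=
    (((hLm _).sub (hLm _)).aestronglyMeasurable).smul_const e
  have hm3 : AEStronglyMeasurable (fun ω => ∫ v in s..u, A.mulVecCLM (X v.toNNReal ω)) P := by
    simp_rw [intervalIntegral.integral_of_le hsu]
    exact hjoint.prod_swap.integral_prod_right'
  rw [eLpNorm_congr_ae heq]
  refine (eLpNorm_add_le hm3 hm2 (by norm_num)).trans ?_
  refine (add_le_add hI ((eLpNorm_smul_const_le _ e).trans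
    (mul_le_mul_right (hLσ s u hs hsu) _))).trans ?_
  have h0 : 0 ≤ u - s := sub_nonneg.2 hsu
  rw [← ENNReal.ofReal_mul h0, ← ENNReal.ofReal_mul (norm_nonneg _),
    ← ENNReal.ofReal_add (by positivity) (by positivity)]
  refine ENNReal.ofReal_le_ofReal ?_
  -- `u - s ≤ √(u - s)` because `u - s ≤ 1`
  have h1 : u - s ≤ √(u - s) := Real.le_sqrt_of_sq_le (by nlinarith)
  have h2 : 0 ≤ ‖A.mulVecCLM‖ * K := by positivity
  nlinarith [mul_le_mul_of_nonneg_right h1 h2]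

end SolvesStateEquation

/-! ### The trapezoidal rule in mean square -/

/-- The error of the trapezoidal rule for the integral of `f` over a single interval `[s,t]`. -/
noncomputable def trapezoidError {E : Type*} [NormedAddCommGroup E] [NormedSpace ℝ E]
    (f : ℝ → E) (s t : ℝ) : E :=
  ((t - s) / 2) • (f s + f t) - ∫ u in s..t, f u

lemma trapezoidError_add {f g : ℝ → ℂ} {s t : ℝ} (hf : IntervalIntegrable f volume s t)
    (hg : IntervalIntegrable g volume s t) :
    trapezoidError (fun u => f u + g u) s t = trapezoidError f s t + trapezoidError g s t := by
  simp only [trapezoidError, intervalIntegral.integral_add hf hg, smul_add]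
  abel

lemma trapezoidError_affine (a c : ℂ) (s t : ℝ) :
    trapezoidError (fun u : ℝ => a + (u - s : ℝ) * c) s t = 0 := by
  have h1 : ∫ u in s..t, (a + ((u - s : ℝ) : ℂ) * c) =
      (t - s : ℝ) * a + ((t - s : ℝ) : ℂ) ^ 2 / 2 * c := by
    rw [intervalIntegral.integral_add intervalIntegrable_const
      (Continuous.intervalIntegrable (by fun_prop) _ _),
      intervalIntegral.integral_mul_const, intervalIntegral.integral_ofReal]
    simp
    left
    ring
  rw [trapezoidError, h1, Complex.real_smul]
  push_cast
  ring

lemma trapezoidError_mul_ofReal (c : ℂ) (f : ℝ → ℝ) (s t : ℝ) :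
    trapezoidError (fun u => c * (f u : ℂ)) s t = c * (trapezoidError f s t : ℝ) := by
  rw [trapezoidError, trapezoidError, intervalIntegral.integral_const_mul,
    intervalIntegral.integral_ofReal]
  simp only [Complex.real_smul, smul_eq_mul]
  push_cast
  ring

section MeanSquare

variable {Ω E : Type*} [MeasurableSpace Ω] {P : Measure Ω} [IsProbabilityMeasure P]
  [NormedAddCommGroup E] [NormedSpace ℝ E]

lemma aestronglyMeasurable_trapezoidError {f : ℝ → Ω → E} {s t : ℝ} (hst : s ≤ t)
    (hf : AEStronglyMeasurable (fun z : ℝ × Ω => f z.1 z.2) ((volume.restrict (Set.Ioc s t)).prod P))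
    (hfu : ∀ u, AEStronglyMeasurable (f u) P) :
    AEStronglyMeasurable (fun ω => trapezoidError (fun u => f u ω) s t) P := by
  unfold trapezoidError
  refine (((hfu s).add (hfu t)).const_smul _).sub ?_
  simp_rw [intervalIntegral.integral_of_le hst]
  exact hf.prod_swap.integral_prod_right'

lemma eLpNorm_trapezoidError_le {f : ℝ → Ω → E} {s t : ℝ} (hst : s ≤ t) {C : ℝ≥0∞}
    (hf : AEStronglyMeasurable (fun z : ℝ × Ω => f z.1 z.2) ((volume.restrict (Set.Ioc s t)).prod P))
    (hfu : ∀ u, AEStronglyMeasurable (f u) P)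
    (hC : ∀ u ∈ Set.Icc s t, eLpNorm (f u) 2 P ≤ C) :
    eLpNorm (fun ω => trapezoidError (fun u => f u ω) s t) 2 P ≤
      ENNReal.ofReal (2 * (t - s)) * C := by
  have h0 : 0 ≤ t - s := sub_nonneg.2 hst
  have hm : AEStronglyMeasurable (fun ω => ∫ u in s..t, f u ω) P := by
    simp_rw [intervalIntegral.integral_of_le hst]
    exact hf.prod_swap.integral_prod_right'
  have h1 : eLpNorm (fun ω => ((t - s) / 2) • (f s ω + f t ω)) 2 P ≤
      ENNReal.ofReal (t - s) * C := by
    have h2 : eLpNorm (fun ω => f s ω + f t ω) 2 P ≤ C + C :=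
      (eLpNorm_add_le (hfu s) (hfu t) (by norm_num)).trans
        (add_le_add (hC s ⟨le_rfl, hst⟩) (hC t ⟨hst, le_rfl⟩))
    have h3 : eLpNorm (fun ω => ((t - s) / 2) • (f s ω + f t ω)) 2 P ≤
        ENNReal.ofReal ((t - s) / 2) * eLpNorm (fun ω => f s ω + f t ω) 2 P :=
      eLpNorm_le_mul_eLpNorm_of_ae_le_mul (Eventually.of_forall fun ω => by
        rw [norm_smul, Real.norm_of_nonneg (by positivity)]) 2
    refine h3.trans ((mul_le_mul_right h2 _).trans (le_of_eq ?_))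
    rw [← two_mul, ← mul_assoc]
    congr 1
    rw [← ENNReal.ofReal_ofNat 2, ← ENNReal.ofReal_mul (by positivity)]
    congr 1
    ring
  have h4 := eLpNorm_two_intervalIntegral_le hst hf fun u hu => hC u ⟨hu.1.le, hu.2⟩
  refine (eLpNorm_sub_le (((hfu s).add (hfu t)).const_smul _) hm (by norm_num)).trans ?_
  refine (add_le_add h1 h4).trans (le_of_eq ?_)
  rw [← two_mul, ← mul_assoc, ENNReal.ofReal_mul (by norm_num), ENNReal.ofReal_ofNat]

lemma memLp_trapezoidError {f : ℝ → Ω → E} {s t : ℝ} (hst : s ≤ t) {C : ℝ≥0∞} (hCtop : C ≠ ⊤)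
    (hf : AEStronglyMeasurable (fun z : ℝ × Ω => f z.1 z.2) ((volume.restrict (Set.Ioc s t)).prod P))
    (hfu : ∀ u, AEStronglyMeasurable (f u) P)
    (hC : ∀ u ∈ Set.Icc s t, eLpNorm (f u) 2 P ≤ C) :
    MemLp (fun ω => trapezoidError (fun u => f u ω) s t) 2 P :=
  ⟨aestronglyMeasurable_trapezoidError hst hf hfu,
    (eLpNorm_trapezoidError_le hst hf hfu hC).trans_lt
      (ENNReal.mul_lt_top ENNReal.ofReal_lt_top hCtop.lt_top)⟩

lemma integral_mul_trapezoidError_eq_zero {V : Ω → ℝ} {f : ℝ → Ω → ℝ} {s t : ℝ} (hst : s ≤ t)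
    {C : ℝ≥0∞} (hCtop : C ≠ ⊤) (hV : MemLp V 2 P)
    (hf : AEStronglyMeasurable (fun z : ℝ × Ω => f z.1 z.2) ((volume.restrict (Set.Ioc s t)).prod P))
    (hfu : ∀ u, AEStronglyMeasurable (f u) P)
    (hC : ∀ u ∈ Set.Icc s t, eLpNorm (f u) 2 P ≤ C)
    (h0 : ∀ u ∈ Set.Icc s t, ∫ ω, V ω * f u ω ∂P = 0) :
    ∫ ω, V ω * trapezoidError (fun u => f u ω) s t ∂P = 0 := by
  have hfL : ∀ u ∈ Set.Icc s t, MemLp (f u) 2 P := fun u hu =>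
    ⟨hfu u, (hC u hu).trans_lt hCtop.lt_top⟩
  have hs := hfL s ⟨le_rfl, hst⟩
  have ht := hfL t ⟨hst, le_rfl⟩
  have hIL : MemLp (fun ω => ∫ u in s..t, f u ω) 2 P := by
    refine ⟨?_, (eLpNorm_two_intervalIntegral_le hst hf
      fun u hu => hC u ⟨hu.1.le, hu.2⟩).trans_lt
        (ENNReal.mul_lt_top ENNReal.ofReal_lt_top hCtop.lt_top)⟩
    simp_rw [intervalIntegral.integral_of_le hst]
    exact hf.prod_swap.integral_prod_right'
  have h1 := integral_mul_intervalIntegral_eq_zero hst hCtop hV hf hfu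
    (fun u hu => hC u ⟨hu.1.le, hu.2⟩) fun u hu => h0 u ⟨hu.1.le, hu.2⟩
  have h2 : ∀ ω, V ω * trapezoidError (fun u => f u ω) s t =
      (t - s) / 2 * (V ω * f s ω) + (t - s) / 2 * (V ω * f t ω) -
        V ω * ∫ u in s..t, f u ω := by
    intro ω
    simp only [trapezoidError, smul_eq_mul]
    ring
  have i1 : Integrable (fun ω => (t - s) / 2 * (V ω * f s ω)) P :=
    (hV.integrable_mul hs).const_mul _
  have i2 : Integrable (fun ω => (t - s) / 2 * (V ω * f t ω)) P :=
    (hV.integrable_mul ht).const_mul _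
  have i3 : Integrable (fun ω => V ω * ∫ u in s..t, f u ω) P := hV.integrable_mul hIL
  simp_rw [h2]
  have i12 : Integrable (fun ω => (t - s) / 2 * (V ω * f s ω) + (t - s) / 2 * (V ω * f t ω)) P :=
    i1.add i2
  rw [integral_sub i12 i3, integral_add i1 i2, integral_const_mul, integral_const_mul,
    h0 s ⟨le_rfl, hst⟩, h0 t ⟨hst, le_rfl⟩, h1]
  simp

end MeanSquare

section Orthogonal

variable {Ω : Type*} [MeasurableSpace Ω] {P : Measure Ω}

lemma eLpNorm_two_eq_sqrt_integral {f : Ω → ℝ} (hf : MemLp f 2 P) :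
    eLpNorm f 2 P = ENNReal.ofReal √(∫ ω, f ω ^ 2 ∂P) := by
  rw [hf.eLpNorm_eq_integral_rpow_norm (by norm_num) (by norm_num), Real.sqrt_eq_rpow]
  norm_num

/-- Pythagoras in `L²`: the squared norms of orthogonal variables add up. -/
lemma eLpNorm_sum_mul_le_of_orthogonal {n : ℕ} {W : ℕ → Ω → ℝ} {κ c : ℕ → ℝ}
    (hW : ∀ j < n, MemLp (W j) 2 P) (horth : ∀ i j, i < j → j < n → ∫ ω, W i ω * W j ω ∂P = 0)
    (hκ : ∀ j < n, 0 ≤ κ j) (hWκ : ∀ j < n, eLpNorm (W j) 2 P ≤ ENNReal.ofReal (κ j))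
    (hc : ∀ j < n, |c j| ≤ 1) :
    eLpNorm (fun ω => ∑ j ∈ Finset.range n, c j * W j ω) 2 P ≤
      ENNReal.ofReal √(∑ j ∈ Finset.range n, κ j ^ 2) := by
  have hmem : MemLp (fun ω => ∑ j ∈ Finset.range n, c j * W j ω) 2 P :=
    memLp_finsetSum _ fun j hj => (hW j (Finset.mem_range.1 hj)).const_mul _
  rw [eLpNorm_two_eq_sqrt_integral hmem]
  refine ENNReal.ofReal_le_ofReal (Real.sqrt_le_sqrt ?_)
  have hsq : ∀ ω, (∑ j ∈ Finset.range n, c j * W j ω) ^ 2 =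
      ∑ i ∈ Finset.range n, ∑ j ∈ Finset.range n, c i * c j * (W i ω * W j ω) := by
    intro ω
    rw [sq, Finset.sum_mul_sum]
    refine Finset.sum_congr rfl fun i _ => Finset.sum_congr rfl fun j _ => ?_
    ring
  have hi : ∀ i ∈ Finset.range n, ∀ j ∈ Finset.range n,
      Integrable (fun ω => c i * c j * (W i ω * W j ω)) P := fun i hi j hj =>
    ((hW i (Finset.mem_range.1 hi)).integrable_mul (hW j (Finset.mem_range.1 hj))).const_mul _
  simp_rw [hsq]
  rw [integral_finsetSum _ fun i h => integrable_finsetSum _ (hi i h)]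
  refine Finset.sum_le_sum fun i hin => ?_
  have hin' := Finset.mem_range.1 hin
  rw [integral_finsetSum _ (hi i hin), Finset.sum_eq_single_of_mem i hin]
  · rw [integral_const_mul]
    have h1 : ∫ ω, W i ω * W i ω ∂P ≤ κ i ^ 2 := by
      have h2 := hWκ i hin'
      rw [eLpNorm_two_eq_sqrt_integral (hW i hin'), ENNReal.ofReal_le_ofReal_iff (hκ i hin'),
        Real.sqrt_le_left (hκ i hin')] at h2
      simpa [sq] using h2
    have h3 : 0 ≤ ∫ ω, W i ω * W i ω ∂P := integral_nonneg fun ω => mul_self_nonneg _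
    have h4 : c i * c i ≤ 1 := by
      have := hc i hin'
      rw [← abs_mul_abs_self]
      nlinarith [abs_nonneg (c i)]
    nlinarith
  · intro j hj hji
    rw [integral_const_mul]
    rcases lt_or_gt_of_ne hji with h | h
    · simp_rw [mul_comm (W i _)]
      rw [horth j i h hin', mul_zero]
    · rw [horth i j h (Finset.mem_range.1 hj), mul_zero]

/-- The version for complex coefficients; the factor `2` comes from bounding real and imaginary
parts separately. -/
lemma eLpNorm_sum_complex_mul_le_of_orthogonal {n : ℕ} {W : ℕ → Ω → ℝ} {κ : ℕ → ℝ} {c : ℕ → ℂ}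
    (hW : ∀ j < n, MemLp (W j) 2 P) (horth : ∀ i j, i < j → j < n → ∫ ω, W i ω * W j ω ∂P = 0)
    (hκ : ∀ j < n, 0 ≤ κ j) (hWκ : ∀ j < n, eLpNorm (W j) 2 P ≤ ENNReal.ofReal (κ j))
    (hc : ∀ j < n, ‖c j‖ ≤ 1) :
    eLpNorm (fun ω => ∑ j ∈ Finset.range n, c j * (W j ω : ℂ)) 2 P ≤
      ENNReal.ofReal (2 * √(∑ j ∈ Finset.range n, κ j ^ 2)) := by
  have hre := eLpNorm_sum_mul_le_of_orthogonal hW horth hκ hWκ (c := fun j => (c j).re)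
    fun j hj => (Complex.abs_re_le_norm _).trans (hc j hj)
  have him := eLpNorm_sum_mul_le_of_orthogonal hW horth hκ hWκ (c := fun j => (c j).im)
    fun j hj => (Complex.abs_im_le_norm _).trans (hc j hj)
  have hm : ∀ a : ℕ → ℝ, AEStronglyMeasurable (fun ω => ∑ j ∈ Finset.range n, a j * W j ω) P :=
    fun a => (memLp_finsetSum _
      fun j hj => (hW j (Finset.mem_range.1 hj)).const_mul _).aestronglyMeasurable
  have h1 : eLpNorm (fun ω => ∑ j ∈ Finset.range n, c j * (W j ω : ℂ)) 2 P ≤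
      eLpNorm (fun ω => |∑ j ∈ Finset.range n, (c j).re * W j ω| +
        |∑ j ∈ Finset.range n, (c j).im * W j ω|) 2 P := by
    refine eLpNorm_mono_real fun ω => ?_
    refine (Complex.norm_le_abs_re_add_abs_im _).trans (le_of_eq ?_)
    simp [Complex.re_sum, Complex.im_sum]
  refine h1.trans ((eLpNorm_add_le (hm _).norm (hm _).norm (by norm_num)).trans ?_)
  rw [eLpNorm_norm, eLpNorm_norm, two_mul,
    ENNReal.ofReal_add (Real.sqrt_nonneg _) (Real.sqrt_nonneg _)]
  exact add_le_add hre him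

end Orthogonal

/-! ### Grids -/

lemma IsGrid.two_le {n : ℕ} {x : ℕ → ℝ} {T : ℝ} (h : IsGrid n x 0 T) (hT : 0 < T) : 2 ≤ n := by
  by_contra hn
  have h1 : n = 1 := by have := h.1; omega
  subst h1
  have h2 := h.2.1
  have h3 := h.2.2.1
  simp only [le_refl, tsub_eq_zero_of_le] at h3
  linarith

lemma IsGrid.mono {n : ℕ} {x : ℕ → ℝ} {a b : ℝ} (h : IsGrid n x a b) {i j : ℕ} (hij : i ≤ j)
    (hj : j < n) : x i ≤ x j :=
  h.2.2.2.monotoneOn (hij.trans_lt hj) hj hij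

lemma sub_le_maxStep {n : ℕ} {x : ℕ → ℝ} {j : ℕ} (hj : j < n - 1) :
    x (j + 1) - x j ≤ maxStep n x :=
  le_ciSup (f := fun j : Fin (n - 1) => x (j + 1) - x j) (Set.finite_range _).bddAbove ⟨j, hj⟩

lemma IsGrid.maxStep_nonneg {n : ℕ} {x : ℕ → ℝ} {a b : ℝ} (h : IsGrid n x a b) :
    0 ≤ maxStep n x :=
  Real.iSup_nonneg fun j => sub_nonneg.2 (h.mono (Nat.le_succ j) (by omega))

lemma IsGrid.sum_sub {n : ℕ} {x : ℕ → ℝ} {a b : ℝ} (h : IsGrid n x a b) :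
    ∑ j ∈ Finset.range (n - 1), (x (j + 1) - x j) = b - a := by
  rw [Finset.sum_range_sub, h.2.1, h.2.2.1]

/-- The trapezoidal sum is the sum of the trapezoids over the individual grid intervals. -/
lemma sum_trapCoeff_mul (F g : ℝ → ℂ) {n : ℕ} (hn : 2 ≤ n) (x : ℕ → ℝ) :
    ∑ j ∈ Finset.range n, trapCoeff F n x j * g (x j) =
      ∑ j ∈ Finset.range (n - 1),
        ((x (j + 1) - x j) / 2) • (F (x j) * g (x j) + F (x (j + 1)) * g (x (j + 1))) := by
  obtain ⟨m, rfl⟩ := Nat.exists_eq_add_of_le' hn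
  have h1 : ∀ j ∈ Finset.range m, trapCoeff F (m + 2) x (j + 1) * g (x (j + 1)) =
      ((x (j + 2) - x (j + 1)) / 2) • (F (x (j + 1)) * g (x (j + 1))) +
        ((x (j + 1) - x j) / 2) • (F (x (j + 1)) * g (x (j + 1))) := by
    intro j hj
    have hj' : j ≠ m := (Finset.mem_range.1 hj).ne
    simp only [trapCoeff, Complex.real_smul]
    simp [hj']
    ring
  have h2 : trapCoeff F (m + 2) x 0 = ((x 1 - x 0) / 2 : ℝ) * F (x 0) := by simp [trapCoeff]
  have h3 : trapCoeff F (m + 2) x (m + 1) =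
      ((x (m + 1) - x m) / 2 : ℝ) * F (x (m + 1)) := by simp [trapCoeff]
  simp only [smul_add, Finset.sum_add_distrib, Nat.add_succ_sub_one]
  rw [Finset.sum_range_succ, Finset.sum_range_succ', Finset.sum_congr rfl h1,
    Finset.sum_add_distrib, h2, h3, Finset.sum_range_succ' (n := m),
    Finset.sum_range_succ (n := m)]
  simp only [Complex.real_smul, zero_add]
  ring

/-! ### The error on a grid -/

/-- The oscillating factor `F(u) = e^{-iwu}`. -/
noncomputable def fourierFactor (w u : ℝ) : ℂ := Complex.exp (-(Complex.I * w * u))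

@[fun_prop] lemma continuous_fourierFactor (w : ℝ) : Continuous (fourierFactor w) := by
  unfold fourierFactor
  fun_prop

lemma norm_fourierFactor (w u : ℝ) : ‖fourierFactor w u‖ = 1 := by
  rw [fourierFactor, Complex.norm_exp]
  simp

lemma norm_fourierFactor_sub_le {w s u : ℝ} (hsu : s ≤ u) (hw : |w| * (u - s) ≤ 1) :
    ‖fourierFactor w u - fourierFactor w s * (1 - Complex.I * w * (u - s : ℝ))‖ ≤
      w ^ 2 * (u - s) ^ 2 := by
  set z : ℂ := -(Complex.I * w * (u - s : ℝ)) with hz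
  have hzn : ‖z‖ = |w| * (u - s) := by
    rw [hz, norm_neg, norm_mul, norm_mul, Complex.norm_I, Complex.norm_real, Complex.norm_real,
      one_mul, Real.norm_eq_abs, Real.norm_of_nonneg (sub_nonneg.2 hsu)]
  have h1 : fourierFactor w u = fourierFactor w s * Complex.exp z := by
    rw [fourierFactor, fourierFactor, ← Complex.exp_add, hz]
    congr 1
    push_cast
    ring
  have h2 : fourierFactor w u - fourierFactor w s * (1 - Complex.I * w * (u - s : ℝ)) =
      fourierFactor w s * (Complex.exp z - 1 - z) := by
    rw [h1, hz]
    ring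
  rw [h2, norm_mul, norm_fourierFactor, one_mul]
  refine (Complex.norm_exp_sub_one_sub_id_le (hzn ▸ hw)).trans (le_of_eq ?_)
  rw [hzn, mul_pow, sq_abs]

namespace SolvesStateEquation

variable {Ω : Type*} [MeasurableSpace Ω] {P : Measure Ω} [IsProbabilityMeasure P] {p : ℕ}
  {A : Matrix (Fin p) (Fin p) ℝ} {e : Fin p → ℝ} {L : ℝ≥0 → Ω → ℝ} {X : ℝ≥0 → Ω → Fin p → ℝ}
  {σ K K' : ℝ}

/-- On `[s,u]` the process `F ℓ(X)` is, up to order `(u - s)^{3/2}` in mean square, the sum of an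
affine function of `u` and of the noise `F(s) ℓ(e) (L(u) - L(s))`. -/
lemma eLpNorm_affine_remainder_le (hX : SolvesStateEquation P A e L X)
    (hL : ∀ᵐ ω ∂P, IsCadlagPath fun t => L t ω)
    (hK : 0 ≤ K) (hXK : ∀ t : ℝ≥0, eLpNorm (X t) 2 P ≤ ENNReal.ofReal K)
    (hK' : 0 ≤ K') (hXK' : ∀ s u : ℝ, 0 ≤ s → s ≤ u → u ≤ s + 1 →
      eLpNorm (fun ω => X u.toNNReal ω - X s.toNNReal ω) 2 P ≤ ENNReal.ofReal (K' * √(u - s)))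
    (l : (Fin p → ℝ) →L[ℝ] ℝ) {w s u : ℝ} (hs : 0 ≤ s) (hsu : s ≤ u) (hus : u ≤ s + 1)
    (hw : |w| * (u - s) ≤ 1) :
    eLpNorm (fun ω => fourierFactor w u * (l (X u.toNNReal ω) : ℂ) -
      ((fourierFactor w s * (l (X s.toNNReal ω) : ℂ) + ((u - s : ℝ) : ℂ) * (fourierFactor w s *
        ((l (A.mulVecCLM (X s.toNNReal ω)) : ℂ) - Complex.I * w * (l (X s.toNNReal ω) : ℂ)))) +
      fourierFactor w s * ((l e * (L u.toNNReal ω - L s.toNNReal ω) : ℝ) : ℂ))) 2 P ≤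
      ENNReal.ofReal ((w ^ 2 * (‖l‖ * K) + ‖l ∘L A.mulVecCLM‖ * K' + |w| * (‖l‖ * K')) *
        ((u - s) * √(u - s))) := by
  have hd : 0 ≤ u - s := sub_nonneg.2 hsu
  set d := u - s with hddef
  set B := l ∘L A.mulVecCLM with hB
  set ρ : ℂ := fourierFactor w u - fourierFactor w s * (1 - Complex.I * w * (d : ℝ)) with hρ
  have hXj := hX.aestronglyMeasurable_uncurry hL (volume.restrict (Set.Ioc s u))
  have hXm : ∀ t, AEStronglyMeasurable (X t) P := fun t => (hX.1 t).aestronglyMeasurable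
  have hJj : AEStronglyMeasurable
      (fun z : ℝ × Ω => B (X z.1.toNNReal z.2 - X s.toNNReal z.2))
      ((volume.restrict (Set.Ioc s u)).prod P) :=
    B.continuous.comp_aestronglyMeasurable (hXj.sub (hXm _).comp_snd)
  set J : Ω → ℝ := fun ω => ∫ v in s..u, B (X v.toNNReal ω - X s.toNNReal ω) with hJ
  have hJm : AEStronglyMeasurable J P := by
    simp only [hJ, intervalIntegral.integral_of_le hsu]
    exact hJj.prod_swap.integral_prod_right'
  have heq : (fun ω => fourierFactor w u * (l (X u.toNNReal ω) : ℂ) -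
      ((fourierFactor w s * (l (X s.toNNReal ω) : ℂ) + (d : ℂ) * (fourierFactor w s *
        ((l (A.mulVecCLM (X s.toNNReal ω)) : ℂ) - Complex.I * w * (l (X s.toNNReal ω) : ℂ)))) +
      fourierFactor w s * ((l e * (L u.toNNReal ω - L s.toNNReal ω) : ℝ) : ℂ))) =ᵐ[P]
      fun ω => ρ * (l (X u.toNNReal ω) : ℂ) + (fourierFactor w s * (J ω : ℂ) +
        fourierFactor w s * -(Complex.I * w * d) *
          (l (X u.toNNReal ω - X s.toNNReal ω) : ℂ)) := by
    filter_upwards [hX.ae_eq_add, hX.ae_intervalIntegrable] with ω hω hint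
    have hAint : IntervalIntegrable (fun v : ℝ => A.mulVecCLM (X v.toNNReal ω)) volume s u :=
      ⟨ContinuousLinearMap.integrable_comp _ (hint s u).1,
        ContinuousLinearMap.integrable_comp _ (hint s u).2⟩
    have hBint : IntervalIntegrable (fun v : ℝ => B (X v.toNNReal ω)) volume s u :=
      ⟨ContinuousLinearMap.integrable_comp _ (hint s u).1,
        ContinuousLinearMap.integrable_comp _ (hint s u).2⟩
    have h1 : l (X u.toNNReal ω) = l (X s.toNNReal ω) + (∫ v in s..u, B (X v.toNNReal ω)) +
        (L u.toNNReal ω - L s.toNNReal ω) * l e := by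
      have h := congrArg l (hω s u hs hsu)
      rw [map_add, map_add, map_smul, ← l.intervalIntegral_comp_comm hAint] at h
      exact h
    have h2 : J ω = (∫ v in s..u, B (X v.toNNReal ω)) - d * l (A.mulVecCLM (X s.toNNReal ω)) := by
      simp only [hJ, map_sub]
      rw [intervalIntegral.integral_sub hBint intervalIntegrable_const,
        intervalIntegral.integral_const, smul_eq_mul]
      rfl
    have h3 : l e * (L u.toNNReal ω - L s.toNNReal ω) = l (X u.toNNReal ω) - l (X s.toNNReal ω) -
        (J ω + d * l (A.mulVecCLM (X s.toNNReal ω))) := by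
      rw [h1, h2]
      ring
    rw [h3, map_sub, hρ]
    push_cast
    ring
  have hY : ∀ t : ℝ≥0, eLpNorm (fun ω => l (X t ω)) 2 P ≤ ENNReal.ofReal (‖l‖ * K) := fun t => by
    rw [ENNReal.ofReal_mul (norm_nonneg _)]
    exact (eLpNorm_clm_apply_le l _ le_rfl).trans (mul_le_mul_right (hXK t) _)
  have hYm : ∀ t : ℝ≥0, AEStronglyMeasurable (fun ω => l (X t ω)) P := fun t =>
    l.continuous.comp_aestronglyMeasurable (hXm t)
  have hDm : AEStronglyMeasurable (fun ω => l (X u.toNNReal ω - X s.toNNReal ω)) P :=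
    l.continuous.comp_aestronglyMeasurable ((hXm _).sub (hXm _))
  have hof : ∀ {f : Ω → ℝ}, AEStronglyMeasurable f P →
      AEStronglyMeasurable (fun ω => (f ω : ℂ)) P := fun h =>
    Complex.continuous_ofReal.comp_aestronglyMeasurable h
  have b1 : eLpNorm (fun ω => ρ * (l (X u.toNNReal ω) : ℂ)) 2 P ≤
      ENNReal.ofReal (w ^ 2 * d ^ 2 * (‖l‖ * K)) := by
    have : eLpNorm (fun ω => ρ * (l (X u.toNNReal ω) : ℂ)) 2 P ≤
        ENNReal.ofReal (w ^ 2 * d ^ 2) * eLpNorm (fun ω => l (X u.toNNReal ω)) 2 P := by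
      refine eLpNorm_le_mul_eLpNorm_of_ae_le_mul (Eventually.of_forall fun ω => ?_) 2
      rw [norm_mul, Complex.norm_real]
      gcongr
      exact norm_fourierFactor_sub_le hsu hw
    refine this.trans ?_
    rw [ENNReal.ofReal_mul (p := w ^ 2 * d ^ 2) (by positivity)]
    gcongr
    exact hY _
  have b2 : eLpNorm (fun ω => fourierFactor w s * (J ω : ℂ)) 2 P ≤
      ENNReal.ofReal (d * (‖B‖ * (K' * √d))) := by
    have h1 : eLpNorm (fun ω => fourierFactor w s * (J ω : ℂ)) 2 P ≤ eLpNorm J 2 P := by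
      refine eLpNorm_mono fun ω => ?_
      rw [norm_mul, Complex.norm_real, norm_fourierFactor, one_mul]
    refine h1.trans ((eLpNorm_two_intervalIntegral_le (P := P)
      (f := fun v ω => B (X v.toNNReal ω - X s.toNNReal ω)) hsu hJj
      (C := ENNReal.ofReal (‖B‖ * (K' * √d))) fun v hv => ?_).trans
        (le_of_eq (ENNReal.ofReal_mul hd).symm))
    refine (eLpNorm_clm_apply_le B _ le_rfl).trans ?_
    rw [ENNReal.ofReal_mul (norm_nonneg _)]
    gcongr
    refine (hXK' s v hs hv.1.le (hv.2.trans hus)).trans (ENNReal.ofReal_le_ofReal ?_)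
    gcongr
    linarith [hv.2]
  have b3 : eLpNorm (fun ω => fourierFactor w s * -(Complex.I * w * d) *
      (l (X u.toNNReal ω - X s.toNNReal ω) : ℂ)) 2 P ≤
      ENNReal.ofReal (|w| * d * (‖l‖ * (K' * √d))) := by
    have : eLpNorm (fun ω => fourierFactor w s * -(Complex.I * w * d) *
        (l (X u.toNNReal ω - X s.toNNReal ω) : ℂ)) 2 P ≤ ENNReal.ofReal (|w| * d) *
        eLpNorm (fun ω => l (X u.toNNReal ω - X s.toNNReal ω)) 2 P := by
      refine eLpNorm_le_mul_eLpNorm_of_ae_le_mul (Eventually.of_forall fun ω => ?_) 2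
      rw [norm_mul, norm_mul, Complex.norm_real, norm_fourierFactor, one_mul, norm_neg, norm_mul,
        norm_mul, Complex.norm_I, one_mul, Complex.norm_real, Complex.norm_real,
        Real.norm_eq_abs w, Real.norm_of_nonneg hd]
    refine this.trans ?_
    rw [ENNReal.ofReal_mul (p := |w| * d) (by positivity)]
    gcongr
    refine (eLpNorm_clm_apply_le l _ le_rfl).trans ?_
    rw [ENNReal.ofReal_mul (norm_nonneg _)]
    gcongr
    exact hXK' s u hs hsu hus
  rw [eLpNorm_congr_ae heq]
  have m1 := (hof (hYm u.toNNReal)).const_mul ρ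
  have m2 := (hof hJm).const_mul (fourierFactor w s)
  have m3 := (hof hDm).const_mul (fourierFactor w s * -(Complex.I * w * d))
  refine (eLpNorm_add_le m1 (m2.add m3) (by norm_num)).trans
    ((add_le_add b1 ((eLpNorm_add_le m2 m3 (by norm_num)).trans (add_le_add b2 b3))).trans ?_)
  rw [← ENNReal.ofReal_add (by positivity) (by positivity),
    ← ENNReal.ofReal_add (by positivity) (by positivity)]
  refine ENNReal.ofReal_le_ofReal ?_
  -- `d² ≤ d √d` because `d ≤ 1`
  have h1 : d ≤ √d := Real.le_sqrt_of_sq_le (by nlinarith)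
  have h2 : d ^ 2 ≤ d * √d := by nlinarith
  have h3 : 0 ≤ w ^ 2 * (‖l‖ * K) := by positivity
  nlinarith [mul_le_mul_of_nonneg_left h2 h3]

/-- The noise parts of the errors on different grid intervals are orthogonal, the increments of `L`
being independent and centred; the remainders are summed by the triangle inequality. -/
lemma eLpNorm_sum_trapezoidError_le (hX : SolvesStateEquation P A e L X)
    (hL : IsLevyProcess P L) (hL2 : MemLp (L 1) 2 P) (hL0 : ∫ ω, L 1 ω ∂P = 0) (hσ : 0 ≤ σ)
    (hLσ : ∀ s u : ℝ, 0 ≤ s → s ≤ u →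
      eLpNorm (fun ω => L u.toNNReal ω - L s.toNNReal ω) 2 P ≤ ENNReal.ofReal (σ * √(u - s)))
    (hK : 0 ≤ K) (hXK : ∀ t : ℝ≥0, eLpNorm (X t) 2 P ≤ ENNReal.ofReal K)
    (hK' : 0 ≤ K') (hXK' : ∀ s u : ℝ, 0 ≤ s → s ≤ u → u ≤ s + 1 →
      eLpNorm (fun ω => X u.toNNReal ω - X s.toNNReal ω) 2 P ≤ ENNReal.ofReal (K' * √(u - s)))
    (l : (Fin p → ℝ) →L[ℝ] ℝ) {w T h : ℝ} {n : ℕ} {x : ℕ → ℝ} (hx : IsGrid n x 0 T)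
    (hh : ∀ j < n - 1, x (j + 1) - x j ≤ h) (hh0 : 0 ≤ h) (hh1 : h ≤ 1) (hwh : |w| * h ≤ 1) :
    eLpNorm (fun ω => ∑ j ∈ Finset.range (n - 1),
      trapezoidError (fun u => fourierFactor w u * (l (X u.toNNReal ω) : ℂ)) (x j) (x (j + 1))) 2 P
      ≤ ENNReal.ofReal (4 * (|l e| * σ) * (h * √T) +
        2 * (w ^ 2 * (‖l‖ * K) + ‖l ∘L A.mulVecCLM‖ * K' + |w| * (‖l‖ * K')) *
          (h * √h * T)) := by
  set C := w ^ 2 * (‖l‖ * K) + ‖l ∘L A.mulVecCLM‖ * K' + |w| * (‖l‖ * K') with hC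
  have hC0 : 0 ≤ C := by positivity
  set d : ℕ → ℝ := fun j => x (j + 1) - x j with hd
  have hstep : ∀ j < n - 1, x j ≤ x (j + 1) := fun j hj => hx.mono (Nat.le_succ j) (by omega)
  have hd0 : ∀ j < n - 1, 0 ≤ d j := fun j hj => sub_nonneg.2 (hstep j hj)
  have hx0 : ∀ j < n - 1, 0 ≤ x j := fun j hj => by
    have := hx.mono (Nat.zero_le j) (by omega)
    rwa [hx.2.1] at this
  have hsumd : ∑ j ∈ Finset.range (n - 1), d j = T := by
    rw [hx.sum_sub, sub_zero]
  have hXm : ∀ t, AEStronglyMeasurable (X t) P := fun t => (hX.1 t).aestronglyMeasurable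
  have hXj : ∀ j, AEStronglyMeasurable (fun z : ℝ × Ω => X z.1.toNNReal z.2)
      ((volume.restrict (Set.Ioc (x j) (x (j + 1)))).prod P) := fun j =>
    hX.aestronglyMeasurable_uncurry hL.cadlag _
  have hof : ∀ {α : Type _} [MeasurableSpace α] {μ : Measure α} {f : α → ℝ},
      AEStronglyMeasurable f μ → AEStronglyMeasurable (fun ω => (f ω : ℂ)) μ := fun h =>
    Complex.continuous_ofReal.comp_aestronglyMeasurable h
  -- the noise on the `j`-th interval
  let g : ℕ → ℝ → Ω → ℝ := fun j u ω => l e * (L u.toNNReal ω - L (x j).toNNReal ω)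
  have hgj : ∀ j, AEStronglyMeasurable (fun z : ℝ × Ω => g j z.1 z.2)
      ((volume.restrict (Set.Ioc (x j) (x (j + 1)))).prod P) := fun j =>
    (((aemeasurable_uncurry_of_rightContinuous hL.measurable
      (hL.cadlag.mono fun ω h s => (h s).1) _).aestronglyMeasurable).sub
        (hL.measurable _).aestronglyMeasurable.comp_snd).const_mul _
  have hgm : ∀ j u, AEStronglyMeasurable (g j u) P := fun j u =>
    (((hL.measurable _).sub (hL.measurable _)).const_mul _).aestronglyMeasurable
  have hgC : ∀ j < n - 1, ∀ u ∈ Set.Icc (x j) (x (j + 1)),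
      eLpNorm (g j u) 2 P ≤ ENNReal.ofReal (|l e| * (σ * √(d j))) := by
    intro j hj u hu
    have h1 : eLpNorm (g j u) 2 P ≤ ENNReal.ofReal |l e| *
        eLpNorm (fun ω => L u.toNNReal ω - L (x j).toNNReal ω) 2 P :=
      eLpNorm_le_mul_eLpNorm_of_ae_le_mul (Eventually.of_forall fun ω => by
        rw [norm_mul, Real.norm_eq_abs (l e)]) 2
    refine h1.trans ?_
    rw [ENNReal.ofReal_mul (abs_nonneg _)]
    gcongr
    refine (hLσ _ _ (hx0 j hj) hu.1).trans (ENNReal.ofReal_le_ofReal ?_)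
    gcongr
    exact sub_le_sub_right hu.2 _
  let W : ℕ → Ω → ℝ := fun j ω => trapezoidError (fun u => g j u ω) (x j) (x (j + 1))
  have hWL : ∀ j < n - 1, MemLp (W j) 2 P := fun j hj =>
    memLp_trapezoidError (hstep j hj) ENNReal.ofReal_ne_top (hgj j) (hgm j) (hgC j hj)
  have hWκ : ∀ j < n - 1, eLpNorm (W j) 2 P ≤
      ENNReal.ofReal (2 * d j * (|l e| * (σ * √(d j)))) := fun j hj => by
    rw [ENNReal.ofReal_mul (by linarith [hd0 j hj])]
    exact eLpNorm_trapezoidError_le (hstep j hj) (hgj j) (hgm j) (hgC j hj)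
  have horth : ∀ i j, i < j → j < n - 1 → ∫ ω, W i ω * W j ω ∂P = 0 := by
    intro i j hij hj
    have hi : i < n - 1 := hij.trans hj
    refine integral_mul_trapezoidError_eq_zero (hstep j hj) ENNReal.ofReal_ne_top (hWL i hi)
      (hgj j) (hgm j) (hgC j hj) fun v hv => ?_
    simp_rw [mul_comm (W i _)]
    refine integral_mul_trapezoidError_eq_zero (hstep i hi) ENNReal.ofReal_ne_top
      ⟨hgm j v, (hgC j hj v hv).trans_lt ENNReal.ofReal_lt_top⟩
      (hgj i) (hgm i) (hgC i hi) fun u hu => ?_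
    have h1 := hL.integral_sub_mul_sub_eq_zero hL2 hL0 (Real.toNNReal_le_toNNReal hu.1)
      (Real.toNNReal_le_toNNReal (hu.2.trans (hx.mono (Nat.succ_le_of_lt hij) (by omega))))
      (Real.toNNReal_le_toNNReal hv.1)
    have h2 : ∀ ω, g j v ω * g i u ω = l e * l e *
        ((L u.toNNReal ω - L (x i).toNNReal ω) * (L v.toNNReal ω - L (x j).toNNReal ω)) := by
      intro ω
      simp only [g]
      ring
    simp_rw [h2]
    rw [integral_const_mul, h1, mul_zero]
  -- the remainder on the `j`-th interval
  let aff : ℕ → ℝ → Ω → ℂ := fun j u ω => fourierFactor w (x j) * (l (X (x j).toNNReal ω) : ℂ) +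
    ((u - x j : ℝ) : ℂ) * (fourierFactor w (x j) * ((l (A.mulVecCLM (X (x j).toNNReal ω)) : ℂ) -
      Complex.I * w * (l (X (x j).toNNReal ω) : ℂ)))
  let R : ℕ → ℝ → Ω → ℂ := fun j u ω => fourierFactor w u * (l (X u.toNNReal ω) : ℂ) -
    (aff j u ω + fourierFactor w (x j) * (g j u ω : ℂ))
  have haffj : ∀ j, AEStronglyMeasurable (fun z : ℝ × Ω => aff j z.1 z.2)
      ((volume.restrict (Set.Ioc (x j) (x (j + 1)))).prod P) := by
    intro j
    have h1 : Measurable fun z : ℝ × Ω => (l (X (x j).toNNReal z.2) : ℂ) :=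
      (Complex.measurable_ofReal.comp (l.measurable.comp (hX.1 _))).comp measurable_snd
    have h2 : Measurable fun z : ℝ × Ω => (l (A.mulVecCLM (X (x j).toNNReal z.2)) : ℂ) :=
      (Complex.measurable_ofReal.comp (l.measurable.comp
        (A.mulVecCLM.measurable.comp (hX.1 _)))).comp measurable_snd
    have h3 : Measurable fun z : ℝ × Ω => ((z.1 - x j : ℝ) : ℂ) := by fun_prop
    exact ((h1.const_mul _).add (h3.mul ((h2.sub (h1.const_mul _)).const_mul _))).aestronglyMeasurable
  have hYj : ∀ j, AEStronglyMeasurable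
      (fun z : ℝ × Ω => fourierFactor w z.1 * (l (X z.1.toNNReal z.2) : ℂ))
      ((volume.restrict (Set.Ioc (x j) (x (j + 1)))).prod P) := fun j =>
    ((continuous_fourierFactor w).measurable.comp measurable_fst).aestronglyMeasurable.mul
      (hof (l.continuous.comp_aestronglyMeasurable (hXj j)))
  have hRj : ∀ j, AEStronglyMeasurable (fun z : ℝ × Ω => R j z.1 z.2)
      ((volume.restrict (Set.Ioc (x j) (x (j + 1)))).prod P) := fun j =>
    (hYj j).sub ((haffj j).add ((hof (hgj j)).const_mul _))
  have hRm : ∀ j u, AEStronglyMeasurable (R j u) P := by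
    intro j u
    have h1 : ∀ t, AEStronglyMeasurable (fun ω => (l (X t ω) : ℂ)) P := fun t =>
      hof (l.continuous.comp_aestronglyMeasurable (hXm t))
    have h2 : ∀ t, AEStronglyMeasurable (fun ω => (l (A.mulVecCLM (X t ω)) : ℂ)) P := fun t =>
      hof (l.continuous.comp_aestronglyMeasurable
        (A.mulVecCLM.continuous.comp_aestronglyMeasurable (hXm t)))
    exact ((h1 _).const_mul _).sub ((((h1 _).const_mul _).add
      ((((h2 _).sub ((h1 _).const_mul _)).const_mul _).const_mul _)).add
        ((hof (hgm j u)).const_mul _))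
  have hRC : ∀ j < n - 1, ∀ u ∈ Set.Icc (x j) (x (j + 1)),
      eLpNorm (R j u) 2 P ≤ ENNReal.ofReal (C * (d j * √(d j))) := by
    intro j hj u hu
    have hu' : u - x j ≤ d j := sub_le_sub_right hu.2 _
    have hdh : d j ≤ h := hh j hj
    refine (hX.eLpNorm_affine_remainder_le hL.cadlag hK hXK hK' hXK' l (hx0 j hj) hu.1
      (by linarith) ((mul_le_mul_of_nonneg_left (hu'.trans hdh) (abs_nonneg w)).trans hwh)).trans
        (ENNReal.ofReal_le_ofReal ?_)
    have := hd0 j hj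
    gcongr
  have hRE : ∀ j < n - 1, eLpNorm (fun ω => trapezoidError (fun u => R j u ω) (x j) (x (j + 1))) 2 P
      ≤ ENNReal.ofReal (2 * d j * (C * (d j * √(d j)))) := fun j hj => by
    rw [ENNReal.ofReal_mul (by linarith [hd0 j hj])]
    exact eLpNorm_trapezoidError_le (hstep j hj) (hRj j) (hRm j) (hRC j hj)
  have heq : (fun ω => ∑ j ∈ Finset.range (n - 1),
      trapezoidError (fun u => fourierFactor w u * (l (X u.toNNReal ω) : ℂ)) (x j) (x (j + 1)))
      =ᵐ[P] fun ω => (∑ j ∈ Finset.range (n - 1), fourierFactor w (x j) * (W j ω : ℂ)) +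
        ∑ j ∈ Finset.range (n - 1), trapezoidError (fun u => R j u ω) (x j) (x (j + 1)) := by
    filter_upwards [hX.ae_eq_add, hX.ae_intervalIntegrable] with ω hω hint
    rw [← Finset.sum_add_distrib]
    refine Finset.sum_congr rfl fun j hj => ?_
    have hj' := Finset.mem_range.1 hj
    have hAint : ∀ a b, IntervalIntegrable (fun v : ℝ => A.mulVecCLM (X v.toNNReal ω)) volume a b :=
      fun a b => ⟨ContinuousLinearMap.integrable_comp _ (hint a b).1,
        ContinuousLinearMap.integrable_comp _ (hint a b).2⟩
    have hlint : IntervalIntegrable (fun v : ℝ => l (X v.toNNReal ω)) volume (x j) (x (j + 1)) :=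
      ⟨l.integrable_comp (hint _ _).1, l.integrable_comp (hint _ _).2⟩
    have hYint : IntervalIntegrable (fun v : ℝ => fourierFactor w v * (l (X v.toNNReal ω) : ℂ))
        volume (x j) (x (j + 1)) := by
      refine IntervalIntegrable.continuousOn_mul ?_ (continuous_fourierFactor w).continuousOn
      exact ⟨hlint.1.ofReal, hlint.2.ofReal⟩
    have hgint : IntervalIntegrable (fun v : ℝ => (g j v ω : ℂ)) volume (x j) (x (j + 1)) := by
      -- the noise path is the state path minus continuous terms
      have h1 : IntervalIntegrable (fun v : ℝ => l (X v.toNNReal ω) -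
          l (X (x j).toNNReal ω + ∫ r in (x j)..v, A.mulVecCLM (X r.toNNReal ω)))
          volume (x j) (x (j + 1)) :=
        hlint.sub (Continuous.intervalIntegrable (l.continuous.comp
          (continuous_const.add (intervalIntegral.continuous_primitive hAint _))) _ _)
      have h2 : IntervalIntegrable (fun v : ℝ => g j v ω) volume (x j) (x (j + 1)) := by
        refine h1.congr fun v hv => ?_
        rw [Set.uIoc_of_le (hstep j hj')] at hv
        have h3 := congrArg l (hω (x j) v (hx0 j hj') hv.1.le)
        rw [map_add, map_smul, smul_eq_mul] at h3
        simp only [g]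
        rw [h3]
        ring
      exact ⟨h2.1.ofReal, h2.2.ofReal⟩
    have haint : IntervalIntegrable (fun v : ℝ => aff j v ω) volume (x j) (x (j + 1)) :=
      Continuous.intervalIntegrable (by fun_prop) _ _
    have hagint : IntervalIntegrable (fun v : ℝ => aff j v ω + fourierFactor w (x j) * (g j v ω : ℂ))
        volume (x j) (x (j + 1)) := haint.add (hgint.const_mul _)
    have hRint : IntervalIntegrable (fun v : ℝ => R j v ω) volume (x j) (x (j + 1)) :=
      hYint.sub hagint
    have h1 := trapezoidError_add hagint hRint
    rw [trapezoidError_add haint (hgint.const_mul _), trapezoidError_affine, zero_add,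
      trapezoidError_mul_ofReal] at h1
    rw [← h1]
    congr 1
    ext u
    simp [R]
  have hmR : ∀ j < n - 1, AEStronglyMeasurable
      (fun ω => trapezoidError (fun u => R j u ω) (x j) (x (j + 1))) P := fun j hj =>
    aestronglyMeasurable_trapezoidError (hstep j hj) (hRj j) (hRm j)
  have hnoise := eLpNorm_sum_complex_mul_le_of_orthogonal hWL horth
    (fun j hj => by have := hd0 j hj; positivity) hWκ
    (c := fun j => fourierFactor w (x j)) fun j _ => (norm_fourierFactor w (x j)).le
  have hrem : eLpNorm (fun ω => ∑ j ∈ Finset.range (n - 1),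
      trapezoidError (fun u => R j u ω) (x j) (x (j + 1))) 2 P ≤
      ENNReal.ofReal (∑ j ∈ Finset.range (n - 1), 2 * d j * (C * (d j * √(d j)))) := by
    rw [ENNReal.ofReal_sum_of_nonneg fun j hj => by
      have := hd0 j (Finset.mem_range.1 hj); positivity]
    have h1 := eLpNorm_sum_le (p := 2) (μ := P) (s := Finset.range (n - 1))
      (f := fun j ω => trapezoidError (fun u => R j u ω) (x j) (x (j + 1)))
      (fun j hj => hmR j (Finset.mem_range.1 hj)) (by norm_num)
    rw [Finset.sum_fn] at h1
    exact h1.trans (Finset.sum_le_sum fun j hj => hRE j (Finset.mem_range.1 hj))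
  have hm1 : AEStronglyMeasurable
      (fun ω => ∑ j ∈ Finset.range (n - 1), fourierFactor w (x j) * (W j ω : ℂ)) P :=
    Finset.aestronglyMeasurable_fun_sum _ fun j hj =>
      (hof (hWL j (Finset.mem_range.1 hj)).aestronglyMeasurable).const_mul _
  have hm2 : AEStronglyMeasurable (fun ω => ∑ j ∈ Finset.range (n - 1),
      trapezoidError (fun u => R j u ω) (x j) (x (j + 1))) P :=
    Finset.aestronglyMeasurable_fun_sum _ fun j hj => hmR j (Finset.mem_range.1 hj)
  rw [eLpNorm_congr_ae heq]
  refine (eLpNorm_add_le hm1 hm2 (by norm_num)).trans ((add_le_add hnoise hrem).trans ?_)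
  have hsum0 : 0 ≤ ∑ j ∈ Finset.range (n - 1), 2 * d j * (C * (d j * √(d j))) :=
    Finset.sum_nonneg fun j hj => by have := hd0 j (Finset.mem_range.1 hj); positivity
  rw [← ENNReal.ofReal_add (by positivity) hsum0]
  refine ENNReal.ofReal_le_ofReal (add_le_add ?_ ?_)
  · have h1 : ∑ j ∈ Finset.range (n - 1), (2 * d j * (|l e| * (σ * √(d j)))) ^ 2 ≤
        (2 * (|l e| * σ) * h) ^ 2 * T := by
      rw [← hsumd, Finset.mul_sum]
      refine Finset.sum_le_sum fun j hj => ?_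
      have hj0 := hd0 j (Finset.mem_range.1 hj)
      have hjh : d j ≤ h := hh j (Finset.mem_range.1 hj)
      have h2 : (2 * d j * (|l e| * (σ * √(d j)))) ^ 2 = (2 * (|l e| * σ) * d j) ^ 2 * d j := by
        have := Real.sq_sqrt hj0
        calc _ = (2 * (|l e| * σ) * d j) ^ 2 * √(d j) ^ 2 := by ring
          _ = _ := by rw [this]
      rw [h2]
      gcongr
    have h3 := Real.sqrt_le_sqrt h1
    rw [Real.sqrt_mul (sq_nonneg _), Real.sqrt_sq (by positivity)] at h3
    linarith
  · rw [← hsumd, Finset.mul_sum, Finset.mul_sum]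
    refine Finset.sum_le_sum fun j hj => ?_
    have hj0 := hd0 j (Finset.mem_range.1 hj)
    have hjh : d j ≤ h := hh j (Finset.mem_range.1 hj)
    calc 2 * d j * (C * (d j * √(d j))) = 2 * C * (d j * √(d j) * d j) := by ring
      _ ≤ 2 * C * (h * √h * d j) := by gcongr

end SolvesStateEquation

/-! ### Convergence of the trapezoidal approximation -/

lemma HasStationaryStart.memLp {Ω : Type*} [MeasurableSpace Ω] {P : Measure Ω} {p : ℕ}
    {A : Matrix (Fin p) (Fin p) ℝ} {e : Fin p → ℝ} {Z : ℝ → Ω → ℝ} {X₀ : Ω → Fin p → ℝ}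
    (h : HasStationaryStart P A e Z X₀) : MemLp X₀ 2 P := by
  obtain ⟨I, hI, hid⟩ := h
  exact hid.memLp_iff.2 (memLp_pi_iff.2 fun i => (hI i).1)

/-- The difference of the two transforms is the normalised sum of the errors of the trapezoidal
rule over the grid intervals. -/
lemma trapezoidalFourier_sub_truncatedFourier {y : ℝ≥0 → ℝ}
    (hy : ∀ a b, IntervalIntegrable (fun s : ℝ => y s.toNNReal) volume a b) (w : ℝ) {T : ℝ}
    (hT : 0 < T) {n : ℕ} {x : ℕ → ℝ} (hx : IsGrid n x 0 T) :
    trapezoidalFourier y w T n x - truncatedFourier y w T = (1 / (√T : ℂ)) *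
      ∑ j ∈ Finset.range (n - 1),
        trapezoidError (fun u => fourierFactor w u * (y u.toNNReal : ℂ)) (x j) (x (j + 1)) := by
  have hint : ∀ a b, IntervalIntegrable (fun u : ℝ => fourierFactor w u * (y u.toNNReal : ℂ))
      volume a b := fun a b =>
    IntervalIntegrable.continuousOn_mul ⟨(hy a b).1.ofReal, (hy a b).2.ofReal⟩
      (continuous_fourierFactor w).continuousOn
  have h1 := intervalIntegral.sum_integral_adjacent_intervals (a := x) (n := n - 1)
    fun k _ => hint (x k) (x (k + 1))
  rw [hx.2.1, hx.2.2.1] at h1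
  have h2 := sum_trapCoeff_mul (fourierFactor w) (fun u => (y u.toNNReal : ℂ)) (hx.two_le hT) x
  simp only [trapezoidError, Finset.sum_sub_distrib]
  rw [← h2, h1, trapezoidalFourier, truncatedFourier, ← mul_sub]
  congr 2
  refine intervalIntegral.integral_congr fun u _ => ?_
  simp only [fourierFactor]
  rw [mul_comm]

/-- From `T = ∑ (x_{j+1} - x_j) ≤ N h` one gets `T h² ≤ N h³ → 0`, and hence `h → 0`. These two
limits are all that the error bound needs. -/
lemma tendsto_maxStep_of_tendsto_mul_pow {N : ℝ → ℕ} {x : ℝ → ℕ → ℝ}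
    (hgrid : ∀ T, 0 < T → IsGrid (N T) (x T) 0 T)
    (hstep : Tendsto (fun T => (N T : ℝ) * maxStep (N T) (x T) ^ 3) atTop (𝓝 0)) :
    Tendsto (fun T => T * maxStep (N T) (x T) ^ 2) atTop (𝓝 0) ∧
      Tendsto (fun T => maxStep (N T) (x T)) atTop (𝓝 0) := by
  have hh0 : ∀ T, 0 < T → 0 ≤ maxStep (N T) (x T) := fun T hT => (hgrid T hT).maxStep_nonneg
  have hTN : ∀ T, 0 < T → T ≤ N T * maxStep (N T) (x T) := by
    intro T hT
    have h1 := (hgrid T hT).sum_sub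
    have h2 := Finset.sum_le_card_nsmul (Finset.range (N T - 1))
      (fun j => x T (j + 1) - x T j) (maxStep (N T) (x T))
      fun j hj => sub_le_maxStep (Finset.mem_range.1 hj)
    rw [h1, Finset.card_range, nsmul_eq_mul, sub_zero] at h2
    refine h2.trans ?_
    have := hh0 T hT
    gcongr
    omega
  have hA : Tendsto (fun T => T * maxStep (N T) (x T) ^ 2) atTop (𝓝 0) := by
    refine squeeze_zero' ?_ ?_ hstep
    · filter_upwards [eventually_gt_atTop 0] with T hT
      positivity
    · filter_upwards [eventually_gt_atTop 0] with T hT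
      calc T * maxStep (N T) (x T) ^ 2 ≤
          N T * maxStep (N T) (x T) * maxStep (N T) (x T) ^ 2 := by
            gcongr
            exact hTN T hT
        _ = _ := by ring
  refine ⟨hA, ?_⟩
  have hs := (Real.continuous_sqrt.tendsto 0).comp hA
  rw [Real.sqrt_zero] at hs
  refine squeeze_zero' ?_ ?_ hs
  · filter_upwards [eventually_gt_atTop 0] with T hT using hh0 T hT
  · filter_upwards [eventually_ge_atTop 1] with T hT
    exact Real.le_sqrt_of_sq_le (le_mul_of_one_le_left (sq_nonneg _) hT)

theorem mainTheorem4 {Ω : Type*} [MeasurableSpace Ω] (P : Measure Ω) [IsProbabilityMeasure P]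
    -- autoregressive and moving average coefficients, of orders `p > q ≥ 0`
    (p : ℕ) (q : Fin p) (a b : Fin p → ℝ) (hbq : b q ≠ 0) (hb : ∀ j, q < j → b j = 0)
    -- the driving Lévy process, centred with finite second moment, and its independent copy
    (L L' : ℝ≥0 → Ω → ℝ) (hL : IsLevyProcess P L) (hL2 : MemLp (L 1) 2 P)
    (hL0 : ∫ ω, L 1 ω ∂P = 0) (hL' : IsLevyProcess P L') (hcopy : IsIndepCopy P L L')
    -- the state process and the CARMA process
    (X : ℝ≥0 → Ω → Fin p → ℝ) (hX : SolvesStateEquation P (carmaMatrix a) (carmaE p) L X)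
    (Y : ℝ≥0 → Ω → ℝ) (hY : ∀ t ω, Y t ω = b ⬝ᵥ X t ω)
    (hindep : IndepFun (X 0) (fun ω t => L t ω) P)
    (hstable : IsHurwitzMatrix (carmaMatrix a))
    (hstart : HasStationaryStart P (carmaMatrix a) (carmaE p) (twoSided L L') (X 0))
    -- the observation grids of `[0,T]`
    (N : ℝ → ℕ) (x : ℝ → ℕ → ℝ) (hgrid : ∀ T, 0 < T → IsGrid (N T) (x T) 0 T)
    (hstep : Tendsto (fun T => (N T : ℝ) * maxStep (N T) (x T) ^ 3) atTop (𝓝 0))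
    (w : ℝ) :
    (∀ T, 0 < T → MemLp (fun ω => trapezoidalFourier (fun t => Y t ω) w T (N T) (x T) -
        truncatedFourier (fun t => Y t ω) w T) 2 P) ∧
      Tendsto (fun T => eLpNorm (fun ω => trapezoidalFourier (fun t => Y t ω) w T (N T) (x T) -
        truncatedFourier (fun t => Y t ω) w T) 2 P) atTop (𝓝 0) ∧
      TendstoInMeasure P (fun T ω => trapezoidalFourier (fun t => Y t ω) w T (N T) (x T) -
        truncatedFourier (fun t => Y t ω) w T) atTop (fun _ => 0) := by
  set A := carmaMatrix a
  set e := carmaE p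
  set σ := √(Var[L 1; P]) 
  have hσ : 0 ≤ σ := Real.sqrt_nonneg _
  have hLσ : ∀ s u : ℝ, 0 ≤ s → s ≤ u →
      eLpNorm (fun ω => L u.toNNReal ω - L s.toNNReal ω) 2 P ≤
        ENNReal.ofReal (σ * √(u - s)) := by
    intro s u hs hsu
    have h := hL.eLpNorm_sub_le hL2 hL0 (Real.toNNReal_le_toNNReal hsu)
    rwa [Real.coe_toNNReal _ hs, Real.coe_toNNReal _ (hs.trans hsu)] at h
  obtain ⟨K, hK, hXK⟩ := hX.exists_forall_eLpNorm_le hL.measurable hL.cadlag hσ hLσ hstable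
    hstart.memLp
  obtain ⟨K', hK', hXK'⟩ := hX.exists_eLpNorm_sub_le hL.measurable hL.cadlag hσ hLσ hK hXK
  let l : (Fin p → ℝ) →L[ℝ] ℝ := ∑ i, b i • ContinuousLinearMap.proj i
  have hYl : ∀ t ω, Y t ω = l (X t ω) := by
    intro t ω
    simp [hY, l, dotProduct]
  let S : ℝ → Ω → ℂ := fun T ω => ∑ j ∈ Finset.range (N T - 1),
    trapezoidError (fun u => fourierFactor w u * (l (X u.toNNReal ω) : ℂ)) (x T j) (x T (j + 1))
  have hdiff : ∀ T, 0 < T → (fun ω => trapezoidalFourier (fun t => Y t ω) w T (N T) (x T) -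
      truncatedFourier (fun t => Y t ω) w T) =ᵐ[P] fun ω => (1 / (√T : ℂ)) * S T ω := by
    intro T hT
    filter_upwards [hX.ae_intervalIntegrable] with ω hω
    simp only [hYl]
    exact trapezoidalFourier_sub_truncatedFourier (y := fun t => l (X t ω))
      (fun a b => ⟨l.integrable_comp (hω a b).1, l.integrable_comp (hω a b).2⟩) w hT (hgrid T hT)
  have hSmem : ∀ T, 0 < T → MemLp (S T) 2 P := by
    intro T hT
    refine memLp_finsetSum _ fun j hj => ?_
    have hj' := Finset.mem_range.1 hj
    have hYm : ∀ u : ℝ, AEStronglyMeasurable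
        (fun ω => fourierFactor w u * (l (X u.toNNReal ω) : ℂ)) P := fun u =>
      (Complex.continuous_ofReal.comp_aestronglyMeasurable
        (l.continuous.comp_aestronglyMeasurable (hX.1 _).aestronglyMeasurable)).const_mul _
    have hYj : AEStronglyMeasurable
        (fun z : ℝ × Ω => fourierFactor w z.1 * (l (X z.1.toNNReal z.2) : ℂ))
        ((volume.restrict (Set.Ioc (x T j) (x T (j + 1)))).prod P) :=
      ((continuous_fourierFactor w).measurable.comp measurable_fst).aestronglyMeasurable.mul
        (Complex.continuous_ofReal.comp_aestronglyMeasurable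
          (l.continuous.comp_aestronglyMeasurable (hX.aestronglyMeasurable_uncurry hL.cadlag _)))
    refine memLp_trapezoidError (C := ENNReal.ofReal ‖l‖ * ENNReal.ofReal K)
      ((hgrid T hT).mono (Nat.le_succ j) (by omega)) (by finiteness) hYj hYm fun u _ => ?_
    have h1 : eLpNorm (fun ω => fourierFactor w u * (l (X u.toNNReal ω) : ℂ)) 2 P ≤
        eLpNorm (fun ω => l (X u.toNNReal ω)) 2 P := by
      refine eLpNorm_mono fun ω => ?_
      rw [norm_mul, Complex.norm_real, norm_fourierFactor, one_mul]
    exact h1.trans ((eLpNorm_clm_apply_le l _ le_rfl).trans (mul_le_mul_right (hXK _) _))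
  have hmem : ∀ T, 0 < T → MemLp (fun ω => trapezoidalFourier (fun t => Y t ω) w T (N T) (x T) -
      truncatedFourier (fun t => Y t ω) w T) 2 P := fun T hT =>
    (memLp_congr_ae (hdiff T hT)).2 ((hSmem T hT).const_mul _)
  obtain ⟨hTh, hh⟩ := tendsto_maxStep_of_tendsto_mul_pow hgrid hstep
  set h : ℝ → ℝ := fun T => maxStep (N T) (x T)
  set C₁ := 4 * (|l e| * σ) with hC₁
  set C₂ := 2 * (w ^ 2 * (‖l‖ * K) + ‖l ∘L A.mulVecCLM‖ * K' + |w| * (‖l‖ * K')) with hC₂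
  have hbound : ∀ᶠ T in atTop, eLpNorm (fun ω =>
      trapezoidalFourier (fun t => Y t ω) w T (N T) (x T) -
        truncatedFourier (fun t => Y t ω) w T) 2 P ≤
      ENNReal.ofReal (C₁ * h T + C₂ * (√(T * h T ^ 2) * √(h T))) := by
    have hw : Tendsto (fun T => |w| * h T) atTop (𝓝 0) := by
      simpa using hh.const_mul |w|
    filter_upwards [eventually_gt_atTop 0, hh.eventually_le_const one_pos,
      hw.eventually_le_const one_pos] with T hT h1 h2
    have hh0 : 0 ≤ h T := (hgrid T hT).maxStep_nonneg
    have hS := hX.eLpNorm_sum_trapezoidError_le hL hL2 hL0 hσ hLσ hK hXK hK' hXK' l (hgrid T hT)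
      (fun j hj => sub_le_maxStep hj) hh0 h1 h2
    rw [eLpNorm_congr_ae (hdiff T hT)]
    have hc : eLpNorm (fun ω => (1 / (√T : ℂ)) * S T ω) 2 P ≤
        ENNReal.ofReal (1 / √T) * eLpNorm (S T) 2 P :=
      eLpNorm_le_mul_eLpNorm_of_ae_le_mul (Eventually.of_forall fun ω => by
        rw [norm_mul, norm_div, norm_one, Complex.norm_real,
          Real.norm_of_nonneg (Real.sqrt_nonneg T)]) 2
    refine hc.trans ((mul_le_mul_right hS _).trans ?_)
    rw [← ENNReal.ofReal_mul (by positivity)]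
    refine ENNReal.ofReal_le_ofReal (le_of_eq ?_)
    have hsT : √T ≠ 0 := (Real.sqrt_pos.2 hT).ne'
    rw [Real.sqrt_mul hT.le, Real.sqrt_sq hh0, ← hC₁, ← hC₂]
    change 1 / √T * (C₁ * (h T * √T) + C₂ * (h T * √(h T) * T)) =
      C₁ * h T + C₂ * (√T * h T * √(h T))
    rw [one_div, inv_mul_eq_iff_eq_mul₀ hsT]
    linear_combination -(C₂ * (h T * √(h T))) * Real.mul_self_sqrt hT.le
  have hlim : Tendsto (fun T => ENNReal.ofReal (C₁ * h T + C₂ * (√(T * h T ^ 2) * √(h T)))) atTop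
      (𝓝 0) := by
    have h1 := (hh.const_mul C₁).add ((hTh.sqrt.mul hh.sqrt).const_mul C₂)
    have h2 := (ENNReal.continuous_ofReal.tendsto _).comp h1
    simp only [Real.sqrt_zero, mul_zero, add_zero, ENNReal.ofReal_zero] at h2
    exact h2
  have hL2lim := tendsto_of_tendsto_of_tendsto_of_le_of_le' tendsto_const_nhds hlim
    (Eventually.of_forall fun _ => zero_le) hbound
  refine ⟨hmem, hL2lim, ?_⟩
  -- convergence in measure asks for measurability at every index, so clip `T` to `[1, ∞)`
  have hclip : TendstoInMeasure P (fun T ω =>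
      trapezoidalFourier (fun t => Y t ω) w (max T 1) (N (max T 1)) (x (max T 1)) -
        truncatedFourier (fun t => Y t ω) w (max T 1)) atTop (fun _ => (0 : ℂ)) := by
    refine tendstoInMeasure_of_tendsto_eLpNorm two_ne_zero
      (fun T => (hmem _ (by positivity)).aestronglyMeasurable) aestronglyMeasurable_const ?_
    refine hL2lim.congr' ?_
    filter_upwards [eventually_ge_atTop 1] with T hT
    rw [max_eq_left hT]
    congr 1
    ext ω
    simp
  intro ε hε
  refine (hclip ε hε).congr' ?_
  filter_upwards [eventually_ge_atTop 1] with T hT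
  rw [max_eq_left hT]
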